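/- **Setting.** Let $\bar n,u,\bar k,\bar d\ge 1$ and $0\le v\le u-1$ be integers, $n=\bar nu$, $k=\bar ku+v$, and assume $\bar k+1\le\bar d\le\bar n-1$. Put $\bar s=\bar d-\bar k+1$ and $l=\bar s^{\lceil\bar n/\bar s\rceil}$. Let $\mathbb F_q$ be a finite field with $u\mid q-1$ and $$q\ \ge\ n\bar s+u\bigl(\Omega(\bar s,u)+(\bar s-1)2^{\bar s-2}\bigr),\qquad \Omega(\bar s,u)=\frac12\sum_{t=1}^{\bar s}\sum_{\delta=t}^{ut}\binom{\bar s-1}{t-1}\binom{ut}{\delta}\binom{\delta-1}{t-1}(\delta-t+1)(\delta+t-2).$$ The $n$ nodes of an array code, each storing a vector in $\mathbb F_q^l$, are divided into $\bar n$ racks of $u$ nodes. The linear code is an $(n,k,l)$ MDS array code if its dimension is $kl$ and every codeword is determined by any $k$ of its nodes. To repair $h$ failed nodes of one rack (the host rack), each rack of a set of other racks (the helper racks) sends symbols of $\mathbb F_q$ computed from its content, and the failed nodes are recovered from these symbols and the $u-h$ surviving nodes of the host rack. The repair bandwidth is the total number of symbols sent by the helper racks; the access is the total number of symbols read on the helper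 racks. **Construction.** For $\theta\in\mathbb F_q$ of multiplicative order $u$ and $\lambda_{p,e}\in\mathbb F_q$ ($0\le p<\bar n$, $0\le e<\bar s$), the coupled-layer code with alignment consists of all $(c_{p,g})_{0\le p<\bar n,\,0\le g<u}$, $c_{p,g}\in\mathbb F_q^l$, with $\sum_{p,g}\mathbf H_{p,g}c_{p,g}=0$. Here the $l$ coordinates are indexed by $i=(i_z)\in\{0,\dots,\bar s-1\}^{\lceil\bar n/\bar s\rceil}$, and $\mathbf H_{p,g}$ is the $l\times l$ block matrix of columns of length $n-k$ defined as follows. Write $p=a\bar s+b$ with $0\le b<\bar s$, and $L(x)=(1,x,\dots,x^{n-k-1})^\top$. The block $(i,j)$ is $0$ unless $i_z=j_z$ for all $z\ne a$; in that case it is $L(\theta^g\lambda_{p,j_a})$ if $i_a=j_a$, it is $-L(\theta^g\lambda_{p,j_a})$ if $i_a=b\ne j_a$, and it is $0$ otherwise. **Theorem 1.** There are $\theta$ of multiplicative order $u$ and $\lambda_{p,e}$ such that the elements $\theta^g\lambda_{p,e}$ ($0\le g<u$, $0\le p<\bar n$, $0\le e<\bar s$) are distinct and the corresponding code is an $(n,k,l)$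 MDS array code with the following properties. 1. For every $h\in[1,u-v]$, any $h$ failed nodes in any one rack can be repaired from any $\bar d$ other racks by downloading $hl/\bar s$ symbols from each of them, i.e. with bandwidth $\bar dhl/\bar s$. This is optimal: no $(n,k,l)$ MDS array code over $\mathbb F_q$ can be repaired from $\bar d$ helper racks with smaller bandwidth. When $h=u-v$, the same repair has access $\bar dhul/(\bar s(u-v))$. This is optimal: for every $h\in[1,u-v]$, any repair of $h$ nodes in one rack from $\bar d$ helper racks, for any $(n,k,l)$ MDS array code over $\mathbb F_q$, that has bandwidth $\bar dhl/\bar s$ and downloads equally many symbols from each helper rack has access at least $\bar dhul/(\bar s(u-v))$. 2. For every $h\in[u-v+1,u]$, any $h$ failed nodes in any one rack can be repaired from any $\bar d$ other racks together with any one additional rack (so this part concerns $\bar d\le\bar n-2$), by downloading $hl/\bar s$ symbols from each of the $\bar d$ racks and $(h-u+v)l/\bar s$ symbols from the additional one. The bandwidth is $$\frac{\bar dhl}{\bar s}+\frac{(h-u+v)l}{\bar s}\ <\ \Bigl(1+\frac1{\bar d}\Bigr)\frac{\bar dhl}{\bar s},$$ where $\bar dhl/\bar s$ is a lower bound for the bandwidth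 of repairing $h$ nodes of one rack from $\bar d$ helper racks, for every $(n,k,l)$ MDS array code over $\mathbb F_q$. -/

import Mathlib

open scoped BigOperators

/-!
Storage nodes are indexed by pairs `(i, g)`: node `g` of rack `i`, with `nbar` racks of `u` nodes.
Each node stores one symbol of `F` for every layer in a finite type `L`, so the sub-packetization
is `Fintype.card L`.
-/

/-- A linear array code over `F` with `nbar` racks of `u` nodes and layers `L`. -/
abbrev RackArrayCode (F : Type*) [Field F] (nbar u : ℕ) (L : Type*) :=
  Submodule F (Fin nbar × Fin u → L → F)

/-- The code is an `(n, k, l)` MDS array code: it encodes `k * l` free symbols, and each codeword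
is determined by any `k` of its nodes. -/
def IsMDSArrayCode {F : Type*} [Field F] {nbar u : ℕ} {L : Type*} [Fintype L]
    (k : ℕ) (C : RackArrayCode F nbar u L) : Prop :=
  Module.finrank F C = k * Fintype.card L ∧
    ∀ K : Finset (Fin nbar × Fin u), K.card = k →
      ∀ c ∈ C, ∀ c' ∈ C, (∀ p ∈ K, c p = c' p) → c = c'

/-- A scheme for repairing the failed nodes `I` of the rack `host` from the helper racks `H`.
Helper rack `j` reads the stored symbols at the positions `access j` (only), and transmits
`load j` symbols of `F` computed from them. The failed nodes are recovered from the transmitted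
symbols and the surviving nodes of the host rack. -/
structure RackRepairScheme {F : Type*} [Field F] {nbar u : ℕ} {L : Type*}
    (C : RackArrayCode F nbar u L) (host : Fin nbar) (I : Finset (Fin u))
    (H : Finset (Fin nbar)) where
  /-- the number of symbols downloaded from each helper rack -/
  load : {j // j ∈ H} → ℕ
  /-- the positions (node of the rack, layer) that are read in each helper rack -/
  access : {j // j ∈ H} → Finset (Fin u × L)
  /-- the symbols sent by each helper rack, as a function of the content of that rack -/
  send : (j : {j // j ∈ H}) → (Fin u → L → F) → Fin (load j) → F
  send_access : ∀ (j : {j // j ∈ H}) (x y : Fin u → L → F),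
    (∀ p ∈ access j, x p.1 p.2 = y p.1 p.2) → send j x = send j y
  /-- the recovery map of the host rack -/
  recover : ((j : {j // j ∈ H}) → Fin (load j) → F) → ({g // g ∉ I} → L → F) →
    {g // g ∈ I} → L → F
  recover_send : ∀ c ∈ C,
    recover (fun j => send j (fun g => c (j.1, g))) (fun g => c (host, g.1)) =
      fun g => c (host, g.1)

/-- The repair bandwidth: the total number of symbols downloaded from the helper racks. -/
def RackRepairScheme.bandwidth {F : Type*} [Field F] {nbar u : ℕ} {L : Type*}
    {C : RackArrayCode F nbar u L} {host : Fin nbar} {I : Finset (Fin u)}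
    {H : Finset (Fin nbar)} (S : RackRepairScheme C host I H) : ℕ :=
  ∑ j, S.load j

/-- The total number of symbols accessed on the helper racks. -/
def RackRepairScheme.accessed {F : Type*} [Field F] {nbar u : ℕ} {L : Type*}
    {C : RackArrayCode F nbar u L} {host : Fin nbar} {I : Finset (Fin u)}
    {H : Finset (Fin nbar)} (S : RackRepairScheme C host I H) : ℕ :=
  ∑ j, (S.access j).card

/-- Every scheme that repairs `h` failed nodes of one rack from `dbar` other racks, for any
MDS array code with the same parameters, has at least `b` as its bandwidth. -/
def IsRackBandwidthLowerBound (F : Type*) [Field F] (nbar u : ℕ) (L : Type*) [Fintype L]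
    (k dbar h : ℕ) (b : ℚ) : Prop :=
  ∀ C : RackArrayCode F nbar u L, IsMDSArrayCode k C →
    ∀ (host : Fin nbar) (I : Finset (Fin u)) (H : Finset (Fin nbar)),
      I.card = h → H.card = dbar → host ∉ H →
        ∀ S : RackRepairScheme C host I H, b ≤ S.bandwidth

/-- Every scheme that repairs `h` failed nodes of one rack from `dbar` other racks, for any
MDS array code with the same parameters, with total bandwidth `b` and with the same number of
symbols downloaded from each helper rack, accesses at least `γ` symbols. -/
def IsRackAccessLowerBound (F : Type*) [Field F] (nbar u : ℕ) (L : Type*) [Fintype L]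
    (k dbar h : ℕ) (b γ : ℚ) : Prop :=
  ∀ C : RackArrayCode F nbar u L, IsMDSArrayCode k C →
    ∀ (host : Fin nbar) (I : Finset (Fin u)) (H : Finset (Fin nbar)),
      I.card = h → H.card = dbar → host ∉ H →
        ∀ S : RackRepairScheme C host I H, (S.bandwidth : ℚ) = b →
          (∀ j j', S.load j = S.load j') → γ ≤ S.accessed

/-- `Ω(s, u) = (1/2) ∑_{t=1}^{s} ∑_{δ=t}^{ut}
  C(s-1, t-1) C(ut, δ) C(δ-1, t-1) (δ-t+1) (δ+t-2)`. -/
def rackOmega (s u : ℕ) : ℚ :=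
  (1 / 2 : ℚ) * ∑ t ∈ Finset.Icc 1 s, ∑ δ ∈ Finset.Icc t (u * t),
    ((s - 1).choose (t - 1) : ℚ) * ((u * t).choose δ : ℚ) * ((δ - 1).choose (t - 1) : ℚ) *
      ((δ : ℚ) - t + 1) * ((δ : ℚ) + t - 2)

/-- The layers: an index `i` in `{0, …, s ^ ⌈nbar / s⌉ - 1}` is given by its base-`s` digits. -/
abbrev RackLayer (nbar s : ℕ) := Fin ⌈(nbar : ℚ) / (s : ℚ)⌉₊ → Fin s

/-- The racks are divided into consecutive groups of `s` racks (the last group may be smaller);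
`rackGroup i` is the index of the group of the rack `i`. -/
def rackGroup {nbar : ℕ} (s : ℕ) [NeZero s] (i : Fin nbar) : Fin ⌈(nbar : ℚ) / (s : ℚ)⌉₊ :=
  ⟨i.1 / s, by
    have hs : (0 : ℚ) < s := by exact_mod_cast Nat.pos_of_ne_zero (NeZero.ne s)
    rw [Nat.lt_ceil, lt_div_iff₀ hs]
    exact_mod_cast lt_of_le_of_lt (Nat.div_mul_le_self i.1 s) i.2⟩

/-- The index of the rack `i` within its group. -/
def rackPos {nbar : ℕ} (s : ℕ) [NeZero s] (i : Fin nbar) : Fin s :=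
  ⟨i.1 % s, Nat.mod_lt _ (Nat.pos_of_ne_zero (NeZero.ne s))⟩

/-- The kernel map: row `t` of the block `(i, j)` of the `s × s` block matrix whose blocks are the
columns `(1, x j, (x j)^2, …)` if `i = j`, the negatives of these if `i = b ≠ j`, and `0`
otherwise. -/
def rackKernel {F : Type*} [Field F] {s : ℕ} (b : Fin s) (x : Fin s → F) (t : ℕ)
    (i j : Fin s) : F :=
  if i = j then x j ^ t else if i = b then -(x j ^ t) else 0

/-- The blow-up of an `s × s` matrix `U` along the digit `a`: the entry `(i, j)` is
`U (i a) (j a)` if `i` and `j` agree in all other digits, and `0` otherwise. -/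
def rackBlowUp {F : Type*} [Field F] {m s : ℕ} (a : Fin m) (U : Fin s → Fin s → F)
    (i j : Fin m → Fin s) : F :=
  if ∀ z, z ≠ a → i z = j z then U (i a) (j a) else 0

/-- The coupled-layer code with `r` parity symbols per layer. The parity-check submatrix of the
node `(p, g)`, where the rack `p` has position `b` in the group `a`, is the blow-up along the
digit `a` of the kernel map `b` at the points `θ ^ g * lam p j`. When `s` does not divide `nbar`,
this is the truncation of the code in which the last group is complete. -/
def coupledLayerCode {F : Type*} [Field F] (nbar u s r : ℕ) [NeZero s] (θ : F)
    (lam : Fin nbar → Fin s → F) : RackArrayCode F nbar u (RackLayer nbar s) where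
  carrier := {c | ∀ (t : Fin r) (i : RackLayer nbar s),
    ∑ p : Fin nbar, ∑ g : Fin u, ∑ j : RackLayer nbar s,
      rackBlowUp (rackGroup s p)
        (rackKernel (rackPos s p) (fun e => θ ^ (g : ℕ) * lam p e) (t : ℕ)) i j * c (p, g) j = 0}
  add_mem' := by
    intro x y hx hy t i
    have h1 := hx t i
    have h2 := hy t i
    simp only [Pi.add_apply, mul_add, Finset.sum_add_distrib]
    rw [h1, h2, add_zero]
  zero_mem' := by
    intro t i
    simp
  smul_mem' := by
    intro a x hx t i
    have h1 := hx t i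
    simp only [Pi.smul_apply, smul_eq_mul, mul_left_comm _ a, ← Finset.mul_sum]
    rw [h1, mul_zero]

open Polynomial

/-! Everything is done in the left kernel of the parity-check matrix. A row combination is a family
`f` of polynomials, one per layer, of degree less than `r`, where `r` is the number of parity
symbols per layer. A codeword is orthogonal to the evaluations of `f` (`coupledLayerCode_pairing`).
To show that some symbols of a codeword vanish, it is enough that the corresponding evaluation
conditions form a square system with only the zero solution `f`.

Such systems are treated one group of racks at a time. The nodes of a group `a` constrain only the
slices of `f` along the digit `a`. They force these slices into an `F[X]`-submodule of `F[X]^s`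
which, by the local condition `IsLocallyIndependent`, has the vectors of degree less than `δ a` as a
complement. Here `δ a` is the number of nodes of the group under consideration. Such a module is
generated by the columns of a matrix `P` with a division algorithm that lowers degrees by `δ a`.
Distinct groups have disjoint evaluation points, so `det P` is invertible modulo the polynomials of
the other groups, and the quotient of `f` by `P` satisfies the other constraints. Dividing group by
group exhausts the degree, so `f = 0` (`eq_zero_of_digitSlice_mem`). This reduces the MDS property
to single groups.

For repair, take `f i = X ^ w * f' i (X ^ u)` with `f'` supported on the layers whose digit in the
host's group is the host's position. Since `θ ^ u = 1`, the `u` nodes of a rack enter only through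
one power sum, the rack symbol. Every other rack enters only in the supporting layers, a fraction
`1/s` of all, while the host enters in all layers. Per supporting layer there are `s` host unknowns
and one unknown for each of the racks `E` that do not help. They are matched by polynomials of
degree less than `ρ = s + #E`, and the same division argument shows that this system is nonsingular
(`eq_zero_of_repairConditions`). The rack symbols with `w < h` then give the `h` failed nodes by a
Vandermonde system. The degree bound `w + u(ρ - 1) < r` holds with `dbar` helpers exactly while `w <
u - v`. One more helper lowers `ρ` by one and admits every `w < u`.

The lower bounds come from a counting form of the cut-set argument (`RackRepairScheme.cutSet`)
followed by averaging. The parameters exist because the product of all determinants that must not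
vanish is a nonzero polynomial whose degree in each variable is less than the field size
(`exists_isLocallyIndependent`). -/

/-! ### Square linear systems and spaces of polynomials -/

/-- A square system with trivial left kernel has trivial right kernel: `ev` is also surjective, so
`Y` can be tested against the unit vectors. -/
theorem eq_zero_of_forall_sum_mul_eq_zero {F V X : Type*} [Field F] [AddCommGroup V] [Module F V]
    [FiniteDimensional F V] [Fintype X] (ev : V →ₗ[F] X → F) (hinj : Function.Injective ev)
    (hdim : Module.finrank F V = Fintype.card X) (Y : X → F)
    (hY : ∀ f, ∑ x, ev f x * Y x = 0) : Y = 0 := by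
  classical
  have hsurj : Function.Surjective ev :=
    (LinearMap.injective_iff_surjective_of_finrank_eq_finrank (by simp [hdim])).1 hinj
  ext x
  obtain ⟨f, hf⟩ := hsurj (Pi.single x 1)
  have := hY f
  rw [hf] at this
  simpa [Pi.single_apply] using this

theorem finrank_pi_degreeLT (F κ : Type*) [Field F] [Fintype κ] (δ : ℕ) :
    Module.finrank F (κ → degreeLT F δ) = Fintype.card κ * δ := by
  rw [Module.finrank_pi_fintype]
  simp [(degreeLTEquiv F δ).finrank_eq]

instance finiteDimensional_degreeLT (F : Type*) [Field F] (δ : ℕ) :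
    FiniteDimensional F (degreeLT F δ) :=
  Module.Finite.equiv (degreeLTEquiv F δ).symm

/-! ### Division in modules of polynomial vectors, one digit at a time -/

/-- The submodule `N` has the vectors of polynomials of degree less than `δ` as a complement,
and contains all multiples of the polynomial `M`. -/
structure IsRemainderModule {F κ : Type*} [Field F] (N : Submodule F[X] (κ → F[X])) (δ : ℕ)
    (M : F[X]) : Prop where
  eq_zero : ∀ v ∈ N, (∀ e, (v e).degree < δ) → v = 0
  exists_rem : ∀ v : κ → F[X], ∃ w : κ → F[X], (∀ e, (w e).degree < δ) ∧ v - w ∈ N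
  smul_mem : ∀ v : κ → F[X], M • v ∈ N

/-- The columns `X ^ δ` times a unit vector, minus its remainder, lie in `N` and have identity
leading coefficient. Long division by them therefore ends in a remainder of degree less than `δ`
lying in `N`, which is zero. Applied to `M` times the unit vectors, division gives `P * Q = M`, so
`det P` divides a power of `M`. -/
theorem IsRemainderModule.exists_matrix {F κ : Type*} [Field F] [Fintype κ] [DecidableEq κ]
    {N : Submodule F[X] (κ → F[X])} {δ : ℕ} {M : F[X]} (hN : IsRemainderModule N δ M) :
    ∃ P : Matrix κ κ F[X],
      (∀ (d : ℕ), ∀ v ∈ N, (∀ e, (v e).degree < d) →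
        ∃ g : κ → F[X], (∀ e, (g e).degree < ((d - δ : ℕ) : WithBot ℕ)) ∧ v = P.mulVec g) ∧
      ∀ M' : F[X], IsCoprime M M' → IsCoprime P.det M' := by
  choose ρ hρ hρN using fun e : κ => hN.exists_rem (Pi.single e (X ^ δ))
  let P : Matrix κ κ F[X] := fun i e => (Pi.single e (X ^ δ) - ρ e : κ → F[X]) i
  have hP : ∀ g, P.mulVec g = ∑ e, g e • (Pi.single e (X ^ δ) - ρ e : κ → F[X]) := by
    intro g
    ext1 i
    simp only [Matrix.mulVec, dotProduct, Finset.sum_apply, Pi.smul_apply, smul_eq_mul, P]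
    exact Finset.sum_congr rfl fun e _ => mul_comm _ _
  have hPN : ∀ g, P.mulVec g ∈ N := fun g => by
    rw [hP]
    exact Submodule.sum_mem _ fun e _ => N.smul_mem _ (hρN e)
  have hdiv : ∀ (d : ℕ), ∀ v ∈ N, (∀ e, (v e).degree < d) →
      ∃ g : κ → F[X], (∀ e, (g e).degree < ((d - δ : ℕ) : WithBot ℕ)) ∧ v = P.mulVec g := by
    intro d
    induction d with
    | zero =>
      intro v hv hd
      refine ⟨0, fun e => by simp, ?_⟩
      rw [Matrix.mulVec_zero]
      exact hN.eq_zero v hv fun e => (hd e).trans_le (by exact_mod_cast Nat.zero_le _)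
    | succ d ih =>
      intro v hv hd
      rcases le_or_gt (d + 1) δ with h | h
      · refine ⟨0, fun e => by simp, ?_⟩
        rw [Matrix.mulVec_zero]
        exact hN.eq_zero v hv fun e => (hd e).trans_le (by exact_mod_cast h)
      · have hδ : δ ≤ d := Nat.lt_succ_iff.1 h
        -- The quotient term that cancels the coefficients of `X ^ d`.
        let g₀ : κ → F[X] := fun e => C ((v e).coeff d) * X ^ (d - δ)
        have hg₀ : ∀ e, (g₀ e).degree ≤ ((d - δ : ℕ) : WithBot ℕ) := fun e =>
          degree_C_mul_X_pow_le _ _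
        obtain ⟨g, hg, hvg⟩ := ih (v - P.mulVec g₀) (N.sub_mem hv (hPN _)) (by
          intro i
          have e1 : (v - P.mulVec g₀) i =
              (v i - C ((v i).coeff d) * X ^ d) + ∑ e, g₀ e * ρ e i := by
            rw [hP, Pi.sub_apply, Finset.sum_apply]
            simp only [Pi.smul_apply, Pi.sub_apply, smul_eq_mul, mul_sub,
              Finset.sum_sub_distrib, Pi.single_apply, mul_ite, mul_zero, Finset.sum_ite_eq,
              Finset.mem_univ, if_true, g₀]
            rw [mul_assoc, ← pow_add, Nat.sub_add_cancel hδ]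
            ring
          rw [e1]
          refine (degree_add_le _ _).trans_lt (max_lt ?_ ?_)
          · rw [degree_lt_iff_coeff_zero]
            intro m hm
            rcases hm.eq_or_lt with rfl | hm
            · simp
            · have := (degree_lt_iff_coeff_zero _ _).1 (hd i) m hm
              rw [coeff_sub, this, coeff_C_mul, coeff_X_pow, if_neg hm.ne']
              simp
          · rw [← mem_degreeLT]
            refine Submodule.sum_mem _ fun e _ => mem_degreeLT.2 ?_
            rw [degree_mul]
            calc (g₀ e).degree + (ρ e i).degree
                ≤ ((d - δ : ℕ) : WithBot ℕ) + (ρ e i).degree := by gcongr; exact hg₀ e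
              _ < ((d - δ : ℕ) : WithBot ℕ) + (δ : ℕ) :=
                WithBot.add_lt_add_left (WithBot.natCast_ne_bot _) (hρ e i)
              _ = d := by rw [← Nat.cast_add, Nat.sub_add_cancel hδ])
        refine ⟨g + g₀, fun e => ?_, ?_⟩
        · refine (degree_add_le _ _).trans_lt (max_lt ((hg e).trans_le ?_) ((hg₀ e).trans_lt ?_))
          · exact_mod_cast by omega
          · exact_mod_cast by omega
        · rw [Matrix.mulVec_add, ← hvg]
          abel
  refine ⟨P, hdiv, fun M' hM => ?_⟩
  have hq : ∀ e : κ, ∃ g : κ → F[X], M • (Pi.single e 1 : κ → F[X]) = P.mulVec g := fun e => by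
    obtain ⟨g, -, hg⟩ := hdiv (M.natDegree + 1) _ (hN.smul_mem (Pi.single e 1)) (by
      intro i
      have : (M • (Pi.single e 1 : κ → F[X])) i = if i = e then M else 0 := by
        simp [Pi.single_apply]
      rw [this]
      split_ifs
      · exact degree_lt_iff_coeff_zero _ _ |>.2 fun m hm =>
          coeff_eq_zero_of_natDegree_lt (by omega)
      · rw [degree_zero]; exact WithBot.bot_lt_coe _)
    exact ⟨g, hg⟩
  choose Q hQ using hq
  have hPQ : P * (Matrix.of fun i e => Q e i) = Matrix.scalar κ M := by
    ext1 i e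
    have := congrFun (hQ e) i
    simp only [Pi.smul_apply, smul_eq_mul, Pi.single_apply] at this
    rw [Matrix.mul_apply, Matrix.scalar_apply, Matrix.diagonal_apply]
    simp only [Matrix.of_apply]
    rw [Matrix.mulVec, dotProduct] at this
    rw [← this]
    simp
  have hdet := congrArg Matrix.det hPQ
  rw [Matrix.det_mul, Matrix.scalar_apply, Matrix.det_diagonal, Finset.prod_const] at hdet
  have h2 : IsCoprime (M ^ (Finset.univ : Finset κ).card) M' := hM.pow_left
  rw [← hdet] at h2
  exact h2.of_mul_left_left

/-- The restriction of a family indexed by digit vectors to a line in the direction `a`. -/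
def digitSlice {ι κ R : Type*} [DecidableEq ι] (a : ι) (f : (ι → κ) → R) (i : ι → κ) : κ → R :=
  fun e => f (Function.update i a e)

theorem digitSlice_update {ι κ R : Type*} [DecidableEq ι] (a : ι) (f : (ι → κ) → R)
    (i : ι → κ) (e : κ) : digitSlice a f (Function.update i a e) = digitSlice a f i := by
  ext e'
  simp [digitSlice]

theorem mem_of_isCoprime_smul_mem {R V : Type*} [CommRing R] [AddCommGroup V] [Module R V]
    (N : Submodule R V) {x y : R} (h : IsCoprime x y) {v : V} (hx : x • v ∈ N) (hy : y • v ∈ N) :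
    v ∈ N := by
  obtain ⟨a, b, hab⟩ := h
  rw [← one_smul R v, ← hab, add_smul, mul_smul, mul_smul]
  exact N.add_mem (N.smul_mem _ hx) (N.smul_mem _ hy)

/-- Induction on the set of constrained digits: divide `f` by the matrix `P` of the digit `a`. The
quotient has degree bound `d - δ a` and still satisfies the constraints in the other digits, because
`det P` is invertible modulo `M a'`. -/
theorem eq_zero_of_digitSlice_mem {F ι κ : Type*} [Field F] [DecidableEq ι] [Fintype κ]
    [DecidableEq κ] (N : ι → Submodule F[X] (κ → F[X])) (δ : ι → ℕ) (M : ι → F[X])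
    (hN : ∀ a, IsRemainderModule (N a) (δ a) (M a))
    (hM : ∀ a a', a ≠ a' → IsCoprime (M a) (M a'))
    (A : Finset ι) :
    ∀ (d : ℕ) (f : (ι → κ) → F[X]), d ≤ ∑ a ∈ A, δ a → (∀ i, (f i).degree < d) →
      (∀ a ∈ A, ∀ i, digitSlice a f i ∈ N a) → f = 0 := by
  induction A using Finset.induction_on with
  | empty =>
    intro d f hd hf _
    ext1 i
    have : d = 0 := by simpa using hd
    subst this
    have := hf i
    rw [degree_lt_iff_coeff_zero] at this
    ext m
    simpa using this m (Nat.zero_le _)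
  | insert a A ha ih =>
    intro d f hd hf hfN
    rw [Finset.sum_insert ha] at hd
    obtain ⟨P, hP, hPM⟩ := (hN a).exists_matrix
    have hG : ∀ i, ∃ g : κ → F[X], (∀ e, (g e).degree < ((d - δ a : ℕ) : WithBot ℕ)) ∧
        digitSlice a f i = P.mulVec g := fun i =>
      hP d _ (hfN a (Finset.mem_insert_self _ _) i) fun e => hf _
    -- The quotient is chosen as a function of the slice alone. Layers on the same line along `a`
    -- then use the same quotient vector, and `g` is well defined with slices `G`.
    let G : (κ → F[X]) → κ → F[X] := fun v =>
      open Classical in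
      if h : ∃ g : κ → F[X], (∀ e, (g e).degree < ((d - δ a : ℕ) : WithBot ℕ)) ∧ v = P.mulVec g
      then h.choose else 0
    have hGs : ∀ i, (∀ e, (G (digitSlice a f i) e).degree < ((d - δ a : ℕ) : WithBot ℕ)) ∧
        digitSlice a f i = P.mulVec (G (digitSlice a f i)) := by
      intro i
      simp only [G]
      rw [dif_pos (hG i)]
      exact (hG i).choose_spec
    let g : (ι → κ) → F[X] := fun i => G (digitSlice a f i) (i a)
    have hg : ∀ i, digitSlice a g i = G (digitSlice a f i) := by
      intro i
      ext1 e
      show G (digitSlice a f (Function.update i a e)) (Function.update i a e a) = _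
      rw [digitSlice_update, Function.update_self]
    have hfg : ∀ i, f i = ∑ e, P (i a) e * g (Function.update i a e) := by
      intro i
      have h1 := congrFun (hGs i).2 (i a)
      rw [← hg] at h1
      simpa [digitSlice, Matrix.mulVec, dotProduct] using h1
    have hg0 : g = 0 := by
      refine ih (d - δ a) g (by omega) (fun i => (hGs i).1 _) ?_
      intro a' ha' i
      have hne : a ≠ a' := fun h => ha (h ▸ ha')
      have hmem : ∀ i, digitSlice a' f i ∈ N a' := hfN a' (Finset.mem_insert_of_mem ha')
      let W : κ → κ → F[X] := fun e => digitSlice a' g (Function.update i a e)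
      -- These combinations are slices of `f` along `a'`. Multiplying by the adjugate of `P`
      -- isolates `det P • W e`, and `M a' • W e` lies in `N a'` as well; coprimality then yields `W
      -- e` itself.
      have hW : ∀ ε, ∑ e, P ε e • W e ∈ N a' := by
        intro ε
        convert hmem (Function.update i a ε) using 1
        ext1 e'
        simp only [Finset.sum_apply, Pi.smul_apply, smul_eq_mul, digitSlice, W]
        rw [hfg]
        refine Finset.sum_congr rfl fun e _ => ?_
        rw [Function.update_of_ne hne, Function.update_self, Function.update_comm hne.symm,
          Function.update_idem]
      have hdet : ∀ e, P.det • W e ∈ N a' := by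
        intro e
        have h1 : P.det • W e = ∑ ε, P.adjugate e ε • ∑ e', P ε e' • W e' := by
          simp_rw [Finset.smul_sum, smul_smul]
          rw [Finset.sum_comm]
          simp_rw [← Finset.sum_smul, ← Matrix.mul_apply]
          rw [Matrix.adjugate_mul]
          simp [Matrix.one_apply, ite_smul]
        rw [h1]
        exact Submodule.sum_mem _ fun ε _ => (N a').smul_mem _ (hW ε)
      have hfin := mem_of_isCoprime_smul_mem (N a') (hPM _ (hM a a' hne)) (hdet (i a))
        ((hN a').smul_mem _)
      simpa [W] using hfin
    ext1 i
    rw [hfg, hg0]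
    simp

/-- The vectors of polynomials satisfying linear conditions at given points. -/
def evalSubmodule {F κ Γ : Type*} [Field F] [Fintype κ] (x : Γ → F) (φ : Γ → κ → F) :
    Submodule F[X] (κ → F[X]) where
  carrier := {v | ∀ γ, ∑ e, φ γ e * (v e).eval (x γ) = 0}
  add_mem' := by
    intro v w hv hw γ
    simp only [Pi.add_apply, eval_add, mul_add, Finset.sum_add_distrib]
    rw [hv γ, hw γ, add_zero]
  zero_mem' := by intro γ; simp
  smul_mem' := by
    intro a v hv γ
    simp only [Pi.smul_apply, smul_eq_mul, eval_mul, mul_left_comm _ (a.eval _), ← Finset.mul_sum]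
    rw [hv γ, mul_zero]

/-- There are as many conditions as coefficients, so uniqueness gives interpolation. The remainder
of `v` is the low-degree vector with the same values of the conditions. -/
theorem isRemainderModule_evalSubmodule {F κ Γ : Type*} [Field F] [Fintype κ] [Fintype Γ]
    (x : Γ → F) (φ : Γ → κ → F) (δ : ℕ) (hcard : Fintype.card Γ = Fintype.card κ * δ)
    (hinj : ∀ v : κ → F[X], (∀ e, (v e).degree < δ) →
      (∀ γ, ∑ e, φ γ e * (v e).eval (x γ) = 0) → v = 0) :
    IsRemainderModule (evalSubmodule x φ) δ (∏ γ, (X - C (x γ))) where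
  eq_zero v hv hd := hinj v hd hv
  exists_rem v := by
    let ev : (κ → degreeLT F δ) →ₗ[F] Γ → F :=
      { toFun := fun w γ => ∑ e, φ γ e * (w e : F[X]).eval (x γ)
        map_add' := by
          intro a b
          ext γ
          simp [mul_add, Finset.sum_add_distrib]
        map_smul' := by
          intro a b
          ext γ
          simp [Finset.mul_sum, mul_left_comm] }
    have hev : Function.Injective ev := by
      rw [injective_iff_map_eq_zero]
      intro w hw
      have := hinj (fun e => (w e : F[X])) (fun e => mem_degreeLT.1 (w e).2)
        (fun γ => congrFun hw γ)
      ext1 e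
      exact Subtype.ext (congrFun this e)
    have hsurj : Function.Surjective ev :=
      (LinearMap.injective_iff_surjective_of_finrank_eq_finrank
        (by rw [finrank_pi_degreeLT, Module.finrank_fintype_fun_eq_card, hcard])).1 hev
    obtain ⟨w, hw⟩ := hsurj fun γ => ∑ e, φ γ e * (v e).eval (x γ)
    refine ⟨fun e => w e, fun e => mem_degreeLT.1 (w e).2, fun γ => ?_⟩
    have := congrFun hw γ
    simp only [Pi.sub_apply, eval_sub, mul_sub, Finset.sum_sub_distrib]
    rw [sub_eq_zero]
    exact this.symm
  smul_mem v γ := by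
    refine Finset.sum_eq_zero fun e _ => ?_
    have : (∏ γ, (X - C (x γ))).eval (x γ) = 0 := by
      rw [eval_prod]
      exact Finset.prod_eq_zero (Finset.mem_univ γ) (by simp)
    simp [this]

theorem isCoprime_prod_X_sub_C {F Γ Γ' : Type*} [Field F] [Fintype Γ] [Fintype Γ']
    (x : Γ → F) (y : Γ' → F) (h : ∀ γ γ', x γ ≠ y γ') :
    IsCoprime (∏ γ, (X - C (x γ))) (∏ γ, (X - C (y γ))) :=
  IsCoprime.prod_left fun γ _ => IsCoprime.prod_right fun γ' _ =>
    isCoprime_X_sub_C_of_isUnit_sub (sub_ne_zero.2 (h γ γ')).isUnit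

/-! ### Pairing codewords with families of polynomials -/

/-- The coefficient pattern of the kernel map `rackKernel`. -/
def kernelCoeff (F : Type*) [Field F] {s : ℕ} (b i j : Fin s) : F :=
  if i = j then 1 else if i = b then -1 else 0

theorem rackKernel_eq {F : Type*} [Field F] {s : ℕ} (b : Fin s) (x : Fin s → F) (t : ℕ)
    (i j : Fin s) : rackKernel b x t i j = kernelCoeff F b i j * x j ^ t := by
  unfold rackKernel kernelCoeff
  split_ifs <;> simp

theorem sum_kernelCoeff_mul {F : Type*} [Field F] {s : ℕ} (b j : Fin s) (y : Fin s → F) :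
    ∑ i, kernelCoeff F b i j * y i = y j - if j = b then 0 else y b := by
  have h : ∀ i, kernelCoeff F b i j * y i =
      (if i = j then y i else 0) - if i = b then (if j = b then 0 else y i) else 0 := by
    intro i
    unfold kernelCoeff
    split_ifs with h1 h2 h3 h3 <;> simp_all
  simp_rw [h, Finset.sum_sub_distrib]
  simp

theorem sum_rackBlowUp_mul {F : Type*} [Field F] {m s : ℕ} (a : Fin m) (U : Fin s → Fin s → F)
    (j : Fin m → Fin s) (G : (Fin m → Fin s) → F) :
    ∑ i, rackBlowUp a U i j * G i = ∑ e, U e (j a) * G (Function.update j a e) := by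
  symm
  refine Finset.sum_of_injOn (fun e => Function.update j a e)
    (Function.update_injective j a).injOn (by simp) ?_ ?_
  · intro i _ hi
    have : rackBlowUp a U i j = 0 := by
      unfold rackBlowUp
      rw [if_neg]
      intro h
      refine hi ⟨i a, by simp, ?_⟩
      ext1 z
      by_cases hz : z = a
      · subst hz; simp
      · simp [hz, h z hz]
    rw [this, zero_mul]
  · intro e _
    have : rackBlowUp a U (Function.update j a e) j = U e (j a) := by
      unfold rackBlowUp
      rw [if_pos fun z hz => by simp [hz], Function.update_self]
    rw [this]

/-- Weight the parity check `(t, i)` by the `t`-th coefficient of `f i` and add. Summing over `t`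
turns powers into evaluations, and the blow-up leaves in column `j` only the rows that differ from
`j` in the digit of the rack's group. -/
theorem coupledLayerCode_pairing {F : Type*} [Field F] {nbar u s r : ℕ} [NeZero s] {θ : F}
    {lam : Fin nbar → Fin s → F} {c : Fin nbar × Fin u → RackLayer nbar s → F}
    (hc : c ∈ coupledLayerCode nbar u s r θ lam) (f : RackLayer nbar s → F[X])
    (hf : ∀ i, (f i).degree < r) :
    ∑ p : Fin nbar, ∑ g : Fin u, ∑ j : RackLayer nbar s,
      (∑ e, kernelCoeff F (rackPos s p) e (j (rackGroup s p)) *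
        (f (Function.update j (rackGroup s p) e)).eval
          (θ ^ (g : ℕ) * lam p (j (rackGroup s p)))) * c (p, g) j = 0 := by
  have h0 : ∑ t : Fin r, ∑ i : RackLayer nbar s, (f i).coeff t *
      ∑ p : Fin nbar, ∑ g : Fin u, ∑ j : RackLayer nbar s,
      rackBlowUp (rackGroup s p)
        (rackKernel (rackPos s p) (fun e => θ ^ (g : ℕ) * lam p e) (t : ℕ)) i j * c (p, g) j
      = 0 := by
    refine Finset.sum_eq_zero fun t _ => Finset.sum_eq_zero fun i _ => ?_
    rw [hc t i, mul_zero]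
  rw [← h0]
  simp_rw [Finset.mul_sum]
  symm
  calc _ = ∑ t : Fin r, ∑ p : Fin nbar, ∑ g : Fin u, ∑ j : RackLayer nbar s,
        ∑ i : RackLayer nbar s, (f i).coeff t * (rackBlowUp (rackGroup s p)
          (rackKernel (rackPos s p) (fun e => θ ^ (g : ℕ) * lam p e) (t : ℕ)) i j *
            c (p, g) j) := by
        refine Finset.sum_congr rfl fun t _ => ?_
        rw [Finset.sum_comm]
        refine Finset.sum_congr rfl fun p _ => ?_
        rw [Finset.sum_comm]
        refine Finset.sum_congr rfl fun g _ => ?_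
        rw [Finset.sum_comm]
    _ = ∑ p : Fin nbar, ∑ g : Fin u, ∑ j : RackLayer nbar s, ∑ t : Fin r,
        ∑ i : RackLayer nbar s, (f i).coeff t * (rackBlowUp (rackGroup s p)
          (rackKernel (rackPos s p) (fun e => θ ^ (g : ℕ) * lam p e) (t : ℕ)) i j *
            c (p, g) j) := by
        rw [Finset.sum_comm]
        refine Finset.sum_congr rfl fun p _ => ?_
        rw [Finset.sum_comm]
        refine Finset.sum_congr rfl fun g _ => ?_
        rw [Finset.sum_comm]
    _ = _ := by
        refine Finset.sum_congr rfl fun p _ => Finset.sum_congr rfl fun g _ =>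
          Finset.sum_congr rfl fun j _ => ?_
        have h1 : ∀ t : Fin r, ∑ i : RackLayer nbar s, (f i).coeff t *
            (rackBlowUp (rackGroup s p)
              (rackKernel (rackPos s p) (fun e => θ ^ (g : ℕ) * lam p e) (t : ℕ)) i j *
              c (p, g) j) =
            ∑ e, (kernelCoeff F (rackPos s p) e (j (rackGroup s p)) *
              (θ ^ (g : ℕ) * lam p (j (rackGroup s p))) ^ (t : ℕ) *
              (f (Function.update j (rackGroup s p) e)).coeff t) * c (p, g) j := by
          intro t
          rw [← Finset.sum_mul]
          simp_rw [← rackKernel_eq (rackPos s p) (fun e => θ ^ (g : ℕ) * lam p e)]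
          rw [← sum_rackBlowUp_mul (rackGroup s p) _ j (fun i => (f i).coeff t), Finset.sum_mul]
          exact Finset.sum_congr rfl fun i _ => by ring
        simp_rw [h1]
        rw [Finset.sum_comm, Finset.sum_mul]
        refine Finset.sum_congr rfl fun e _ => ?_
        rw [← Finset.sum_mul, eval_eq_sum_degreeLTEquiv (mem_degreeLT.2 (hf _))]
        congr 1
        rw [Finset.mul_sum]
        refine Finset.sum_congr rfl fun t _ => ?_
        simp only [degreeLTEquiv, LinearEquiv.coe_mk]
        show _ = _ * ((f _).coeff t * _)
        ring

/-! ### Local independence and the MDS property -/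

/-- The local constraint of a coupled-layer code: within one group of racks, the parity-check
submatrix of any set of `δ` nodes with `δ` parity symbols per layer is invertible. It is stated
in terms of the left kernel of this matrix. -/
def IsLocallyIndependent {F : Type*} [Field F] {nbar : ℕ} (u s : ℕ) [NeZero s] (θ : F)
    (lam : Fin nbar → Fin s → F) : Prop :=
  ∀ (a : Fin ⌈(nbar : ℚ) / (s : ℚ)⌉₊) (D : Finset (Fin nbar × Fin u)),
    (∀ d ∈ D, rackGroup s d.1 = a) → ∀ v : Fin s → F[X], (∀ e, (v e).degree < D.card) →
      (∀ d ∈ D, ∀ e, ∑ e', kernelCoeff F (rackPos s d.1) e' e *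
        (v e').eval (θ ^ (d.2 : ℕ) * lam d.1 e) = 0) → v = 0

/-- The evaluation conditions imposed by the nodes of `D` in the group `a`. -/
abbrev groupEvalSubmodule {F : Type*} [Field F] {nbar u s : ℕ} [NeZero s] (θ : F)
    (lam : Fin nbar → Fin s → F) (D : Finset (Fin nbar × Fin u))
    (a : Fin ⌈(nbar : ℚ) / (s : ℚ)⌉₊) : Submodule F[X] (Fin s → F[X]) :=
  evalSubmodule
    (fun γ : {d // d ∈ D.filter fun d => rackGroup s d.1 = a} × Fin s =>
      θ ^ (γ.1.1.2 : ℕ) * lam γ.1.1.1 γ.2)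
    (fun γ e => kernelCoeff F (rackPos s γ.1.1.1) e γ.2)

theorem IsLocallyIndependent.isRemainderModule {F : Type*} [Field F] {nbar u s : ℕ} [NeZero s]
    {θ : F} {lam : Fin nbar → Fin s → F} (hloc : IsLocallyIndependent u s θ lam)
    (D : Finset (Fin nbar × Fin u)) (a : Fin ⌈(nbar : ℚ) / (s : ℚ)⌉₊) :
    IsRemainderModule (groupEvalSubmodule θ lam D a)
      (D.filter fun d => rackGroup s d.1 = a).card
      (∏ γ : {d // d ∈ D.filter fun d => rackGroup s d.1 = a} × Fin s,
        (X - C (θ ^ (γ.1.1.2 : ℕ) * lam γ.1.1.1 γ.2))) := by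
  refine isRemainderModule_evalSubmodule _ _ _
    (by rw [Fintype.card_prod, Fintype.card_coe, mul_comm]) ?_
  intro v hv hev
  exact hloc a (D.filter fun d => rackGroup s d.1 = a) (fun d hd => (Finset.mem_filter.1 hd).2) v
    hv fun d hd e => hev (⟨d, hd⟩, e)

/-- The passage from one group to all: the nodes of `D` split by group, the `δ a` add up to
`D.card`, and distinct groups have coprime moduli because their points are disjoint. -/
theorem eq_zero_of_evalConditions {F : Type*} [Field F] {nbar u s : ℕ} [NeZero s] {θ : F}
    {lam : Fin nbar → Fin s → F}
    (hinj : Function.Injective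
      (fun x : Fin u × Fin nbar × Fin s => θ ^ (x.1 : ℕ) * lam x.2.1 x.2.2))
    (hloc : IsLocallyIndependent u s θ lam) (D : Finset (Fin nbar × Fin u))
    (f : RackLayer nbar s → F[X]) (hf : ∀ i, (f i).degree < D.card)
    (hev : ∀ d ∈ D, ∀ j : RackLayer nbar s,
      ∑ e, kernelCoeff F (rackPos s d.1) e (j (rackGroup s d.1)) *
        (f (Function.update j (rackGroup s d.1) e)).eval
          (θ ^ (d.2 : ℕ) * lam d.1 (j (rackGroup s d.1))) = 0) : f = 0 := by
  refine eq_zero_of_digitSlice_mem (groupEvalSubmodule θ lam D) _ _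
    (hloc.isRemainderModule D) ?_ Finset.univ D.card f ?_ hf ?_
  · intro a a' haa'
    refine isCoprime_prod_X_sub_C _ _ fun γ γ' h => haa' ?_
    have h1 := @hinj (γ.1.1.2, γ.1.1.1, γ.2) (γ'.1.1.2, γ'.1.1.1, γ'.2) h
    rw [← (Finset.mem_filter.1 γ.1.2).2, ← (Finset.mem_filter.1 γ'.1.2).2]
    simp only [Prod.mk.injEq] at h1
    rw [h1.2.1]
  · exact (Finset.card_eq_sum_card_fiberwise fun d _ => Finset.mem_univ _).le
  · rintro a - i ⟨⟨d, hd⟩, e⟩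
    obtain rfl := (Finset.mem_filter.1 hd).2
    have := hev d (Finset.mem_filter.1 hd).1 (Function.update i (rackGroup s d.1) e)
    simpa [digitSlice] using this

theorem coupledLayerCode_eq_zero_of_support {F : Type*} [Field F] {nbar u s r : ℕ} [NeZero s]
    {θ : F} {lam : Fin nbar → Fin s → F}
    (hinj : Function.Injective
      (fun x : Fin u × Fin nbar × Fin s => θ ^ (x.1 : ℕ) * lam x.2.1 x.2.2))
    (hloc : IsLocallyIndependent u s θ lam) (D : Finset (Fin nbar × Fin u)) (hD : D.card = r)
    {c : Fin nbar × Fin u → RackLayer nbar s → F}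
    (hc : c ∈ coupledLayerCode nbar u s r θ lam) (hcD : ∀ d ∉ D, c d = 0) : c = 0 := by
  let ev : (RackLayer nbar s → degreeLT F r) →ₗ[F] ({d // d ∈ D} × RackLayer nbar s) → F :=
    { toFun := fun f x => ∑ e, kernelCoeff F (rackPos s x.1.1.1) e (x.2 (rackGroup s x.1.1.1)) *
        (f (Function.update x.2 (rackGroup s x.1.1.1) e) : F[X]).eval
          (θ ^ (x.1.1.2 : ℕ) * lam x.1.1.1 (x.2 (rackGroup s x.1.1.1)))
      map_add' := by
        intro a b
        ext γ
        simp [mul_add, Finset.sum_add_distrib]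
      map_smul' := by
        intro a b
        ext γ
        simp [Finset.mul_sum, mul_left_comm] }
  have hev : Function.Injective ev := by
    rw [injective_iff_map_eq_zero]
    intro f hf
    have := eq_zero_of_evalConditions hinj hloc D (fun i => (f i : F[X]))
      (fun i => by rw [hD]; exact mem_degreeLT.1 (f i).2)
      (fun d hd j => congrFun hf (⟨d, hd⟩, j))
    ext1 i
    exact Subtype.ext (congrFun this i)
  have hY := eq_zero_of_forall_sum_mul_eq_zero ev hev
    (by rw [finrank_pi_degreeLT]; simp [hD, mul_comm])
    (fun x => c x.1.1 x.2) (by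
      intro f
      let G : Fin nbar × Fin u → F := fun d => ∑ j : RackLayer nbar s,
        (∑ e, kernelCoeff F (rackPos s d.1) e (j (rackGroup s d.1)) *
          (f (Function.update j (rackGroup s d.1) e) : F[X]).eval
            (θ ^ (d.2 : ℕ) * lam d.1 (j (rackGroup s d.1)))) * c d j
      have h1 : ∑ d, G d = 0 := by
        rw [Fintype.sum_prod_type]
        exact coupledLayerCode_pairing hc (fun i => (f i : F[X]))
          (fun i => mem_degreeLT.1 (f i).2)
      rw [← h1, ← Finset.sum_subset (Finset.subset_univ D), ← Finset.sum_coe_sort D,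
        Fintype.sum_prod_type]
      · rfl
      · intro d _ hd
        exact Finset.sum_eq_zero fun j _ => by simp [hcD d hd])
  ext d j
  by_cases hd : d ∈ D
  · exact congrFun hY (⟨d, hd⟩, j)
  · rw [hcD d hd]
    rfl

theorem coupledLayerCode_isMDSArrayCode {F : Type*} [Field F] {nbar u s k : ℕ} [NeZero s]
    {θ : F} {lam : Fin nbar → Fin s → F} (hk : k ≤ nbar * u)
    (hinj : Function.Injective
      (fun x : Fin u × Fin nbar × Fin s => θ ^ (x.1 : ℕ) * lam x.2.1 x.2.2))
    (hloc : IsLocallyIndependent u s θ lam) :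
    IsMDSArrayCode k (coupledLayerCode nbar u s (nbar * u - k) θ lam) := by
  set C := coupledLayerCode nbar u s (nbar * u - k) θ lam with hC
  have hsep : ∀ K : Finset (Fin nbar × Fin u), K.card = k →
      ∀ c ∈ C, ∀ c' ∈ C, (∀ p ∈ K, c p = c' p) → c = c' := by
    intro K hK c hc c' hc' h
    rw [← sub_eq_zero]
    refine coupledLayerCode_eq_zero_of_support hinj hloc Kᶜ
      (by rw [Finset.card_compl, hK]; simp) (C.sub_mem hc hc') fun d hd => ?_
    rw [Pi.sub_apply, h d (by simpa using hd), sub_self]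
  refine ⟨le_antisymm ?_ ?_, hsep⟩
  · obtain ⟨K, -, hK⟩ := Finset.exists_subset_card_eq
      (s := (Finset.univ : Finset (Fin nbar × Fin u))) (n := k) (by simpa using hk)
    let π : C →ₗ[F] ({d // d ∈ K} → RackLayer nbar s → F) :=
      { toFun := fun c d => c.1 d.1
        map_add' := fun _ _ => rfl
        map_smul' := fun _ _ => rfl }
    have hπ : Function.Injective π := fun c c' h =>
      Subtype.ext (hsep K hK c c.2 c' c'.2 fun p hp => congrFun h ⟨p, hp⟩)
    refine (LinearMap.finrank_le_finrank_of_injective hπ).trans (le_of_eq ?_)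
    rw [Module.finrank_pi_fintype]
    simp [hK]
  -- The lower bound on the dimension is rank-nullity: the code is the kernel of `nbar * u - k`
  -- equations per layer.
  · let T : (Fin nbar × Fin u → RackLayer nbar s → F) →ₗ[F]
        (Fin (nbar * u - k) → RackLayer nbar s → F) :=
      { toFun := fun c t i => ∑ p : Fin nbar, ∑ g : Fin u, ∑ j : RackLayer nbar s,
          rackBlowUp (rackGroup s p)
            (rackKernel (rackPos s p) (fun e => θ ^ (g : ℕ) * lam p e) (t : ℕ)) i j * c (p, g) j
        map_add' := by
          intro x y
          ext t i
          simp only [Pi.add_apply, mul_add, Finset.sum_add_distrib]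
        map_smul' := by
          intro a x
          ext t i
          simp only [Pi.smul_apply, smul_eq_mul, mul_left_comm _ a, ← Finset.mul_sum,
            RingHom.id_apply] }
    have hT : C = LinearMap.ker T := by
      ext c
      rw [LinearMap.mem_ker]
      exact ⟨fun h => funext fun t => funext fun i => h t i,
        fun h t i => congrFun (congrFun h t) i⟩
    have h1 := LinearMap.finrank_range_add_finrank_ker T
    have h2 := Submodule.finrank_le (LinearMap.range T)
    rw [← hT] at h1
    rw [Module.finrank_pi_fintype] at h1 h2
    simp only [Module.finrank_fintype_fun_eq_card, Finset.sum_const, Finset.card_univ,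
      Fintype.card_prod, Fintype.card_fin, smul_eq_mul] at h1 h2
    rw [Nat.sub_mul] at h2
    have h3 := Nat.mul_le_mul_right (Fintype.card (RackLayer nbar s)) hk
    omega

/-! ### Rack symbols and the repair equations -/

theorem rack_ext {nbar s : ℕ} [NeZero s] {p q : Fin nbar} (h : rackGroup s p = rackGroup s q)
    (h' : rackPos s p = rackPos s q) : p = q := by
  have h1 : p.1 / s = q.1 / s := congrArg Fin.val h
  have h2 : p.1 % s = q.1 % s := congrArg Fin.val h'
  ext
  rw [← Nat.div_add_mod p.1 s, h1, h2, Nat.div_add_mod]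

theorem degree_X_pow_mul_expand_lt {F : Type*} [Field F] {u ρ w r : ℕ} (hu : 0 < u) (hρ : 0 < ρ)
    (hr : w + u * (ρ - 1) < r) {f : F[X]} (hf : f.degree < ρ) :
    (X ^ w * expand F u f).degree < (r : WithBot ℕ) := by
  rw [degree_lt_iff_coeff_zero] at hf ⊢
  intro m hm
  rw [coeff_X_pow_mul']
  split_ifs with h
  · rw [coeff_expand hu]
    split_ifs with h'
    · obtain ⟨q, hq⟩ := h'
      rw [hq, Nat.mul_div_cancel_left _ hu]
      refine hf q ?_
      have : u * (ρ - 1) < u * q := by omega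
      have := Nat.lt_of_mul_lt_mul_left this
      omega
    · rfl
  · rfl

/-- The `w`-th power-weighted sum of the symbols which a rack stores in the layer `j`. -/
def rackSymbol {F : Type*} [Field F] {nbar u s : ℕ} [NeZero s] (θ : F) (lam : Fin nbar → Fin s → F)
    (c : Fin nbar × Fin u → RackLayer nbar s → F) (p : Fin nbar) (j : RackLayer nbar s)
    (w : ℕ) : F :=
  ∑ g : Fin u, (θ ^ (g : ℕ) * lam p (j (rackGroup s p))) ^ w * c (p, g) j

/-- The coefficient of the rack symbol of `p` in the layer `j` in the parity check given by the
family of polynomials `f` at the `u`-th powers of the evaluation points. -/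
def rackCoeff {F : Type*} [Field F] {nbar s : ℕ} [NeZero s] (u : ℕ) (lam : Fin nbar → Fin s → F)
    (f : RackLayer nbar s → F[X]) (p : Fin nbar) (j : RackLayer nbar s) : F :=
  ∑ e, kernelCoeff F (rackPos s p) e (j (rackGroup s p)) *
    (f (Function.update j (rackGroup s p) e)).eval (lam p (j (rackGroup s p)) ^ u)

/-- Pair with `X ^ w * f i (X ^ u)`. As `θ ^ u = 1`, the second factor is the same at all `u` nodes
of a rack, so only the sum weighted by `w`-th powers remains. -/
theorem sum_rackCoeff_mul_rackSymbol {F : Type*} [Field F] {nbar u s r : ℕ} [NeZero s] {θ : F}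
    {lam : Fin nbar → Fin s → F} (hθ : θ ^ u = 1) (hu : 0 < u)
    {c : Fin nbar × Fin u → RackLayer nbar s → F} (hc : c ∈ coupledLayerCode nbar u s r θ lam)
    {ρ w : ℕ} (hρ : 0 < ρ) (hr : w + u * (ρ - 1) < r) (f : RackLayer nbar s → F[X])
    (hf : ∀ i, (f i).degree < ρ) :
    ∑ p : Fin nbar, ∑ j : RackLayer nbar s,
      rackCoeff u lam f p j * rackSymbol θ lam c p j w = 0 := by
  rw [← coupledLayerCode_pairing hc (fun i => X ^ w * expand F u (f i))
    fun i => degree_X_pow_mul_expand_lt hu hρ hr (hf i)]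
  refine Finset.sum_congr rfl fun p _ => ?_
  rw [Finset.sum_comm]
  refine Finset.sum_congr rfl fun j _ => ?_
  unfold rackCoeff rackSymbol
  rw [Finset.mul_sum]
  refine Finset.sum_congr rfl fun g _ => ?_
  have hx : (θ ^ (g : ℕ) * lam p (j (rackGroup s p))) ^ u = lam p (j (rackGroup s p)) ^ u := by
    rw [mul_pow, ← pow_mul, mul_comm (g : ℕ), pow_mul, hθ, one_pow, one_mul]
  simp only [eval_mul, eval_pow, eval_X, expand_eval, hx]
  rw [← mul_assoc, Finset.sum_mul]
  congr 1
  exact Finset.sum_congr rfl fun e _ => by ring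

/-- This is the alignment that saves the factor `s`. A rack of another group does not change the
host's digit, so it meets only zero polynomials. For a rack of the host's group, the one nonzero
polynomial has kernel coefficient zero, since the host's position is neither `j`'s digit nor the
rack's own position. -/
theorem rackCoeff_eq_zero {F : Type*} [Field F] {nbar u s : ℕ} [NeZero s]
    (lam : Fin nbar → Fin s → F) {f : RackLayer nbar s → F[X]} {host p : Fin nbar}
    (hp : p ≠ host) (hf : ∀ i, i (rackGroup s host) ≠ rackPos s host → f i = 0)
    {j : RackLayer nbar s} (hj : j (rackGroup s host) ≠ rackPos s host) :
    rackCoeff u lam f p j = 0 := by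
  refine Finset.sum_eq_zero fun e _ => ?_
  by_cases ha : rackGroup s p = rackGroup s host
  · by_cases he : e = rackPos s host
    · have hb : rackPos s p ≠ rackPos s host := fun h => hp (rack_ext ha h)
      subst he
      rw [ha, kernelCoeff, if_neg hj.symm, if_neg hb.symm, zero_mul]
    · rw [hf, eval_zero, mul_zero]
      rw [ha, Function.update_self]
      exact he
  · rw [hf, eval_zero, mul_zero]
    rw [Function.update_of_ne (Ne.symm ha)]
    exact hj

theorem rackCoeff_same_group {F : Type*} [Field F] {nbar u s : ℕ} [NeZero s]
    (lam : Fin nbar → Fin s → F) {f : RackLayer nbar s → F[X]} {host p : Fin nbar}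
    (ha : rackGroup s p = rackGroup s host)
    (hf : ∀ i, i (rackGroup s host) ≠ rackPos s host → f i = 0) (j : RackLayer nbar s) :
    rackCoeff u lam f p j =
      kernelCoeff F (rackPos s p) (rackPos s host) (j (rackGroup s host)) *
        (f (Function.update j (rackGroup s host) (rackPos s host))).eval
          (lam p (j (rackGroup s host)) ^ u) := by
  unfold rackCoeff
  rw [Finset.sum_eq_single (rackPos s host), ha]
  · intro e _ he
    rw [hf, eval_zero, mul_zero]
    rw [ha, Function.update_self]
    exact he
  · simp

/-- Extension by zero of a family on the layers with digit `b` in position `a`. -/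
def extendLayer {R : Type*} [Zero R] {m s : ℕ} (a : Fin m) (b : Fin s)
    (f : {i : Fin m → Fin s // i a = b} → R) (i : Fin m → Fin s) : R :=
  if h : i a = b then f ⟨i, h⟩ else 0

/-- Constant extension of a family on the layers with digit `b` in position `a`. -/
def constLayer {R : Type*} {m s : ℕ} (a : Fin m) (b : Fin s)
    (f : {i : Fin m → Fin s // i a = b} → R) (i : Fin m → Fin s) : R :=
  f ⟨Function.update i a b, Function.update_self _ _ _⟩

theorem extendLayer_eq_constLayer {R : Type*} [Zero R] {m s : ℕ} {a : Fin m} {b : Fin s}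
    (f : {i : Fin m → Fin s // i a = b} → R) {i : Fin m → Fin s} (h : i a = b) :
    extendLayer a b f i = constLayer a b f i := by
  unfold extendLayer constLayer
  rw [dif_pos h]
  subst h
  simp

theorem extendLayer_eq_zero {R : Type*} [Zero R] {m s : ℕ} {a : Fin m} {b : Fin s}
    (f : {i : Fin m → Fin s // i a = b} → R) {i : Fin m → Fin s} (h : i a ≠ b) :
    extendLayer a b f i = 0 := dif_neg h

theorem constLayer_update {R : Type*} {m s : ℕ} {a : Fin m} {b : Fin s}
    (f : {i : Fin m → Fin s // i a = b} → R) (i : Fin m → Fin s) (e : Fin s) :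
    constLayer a b f (Function.update i a e) = constLayer a b f i := by
  simp [constLayer]

/-- The nonsingularity behind the repair of a rack: the conditions at all points of the host and at
the racks of `E` determine a family of polynomials of degree less than `s + #E`. -/
theorem eq_zero_of_repairConditions {F : Type*} [Field F] {nbar u s : ℕ} [NeZero s] {θ : F}
    {lam : Fin nbar → Fin s → F} (hθ : θ ^ u = 1) (hu : 0 < u)
    (hinj : Function.Injective
      (fun x : Fin u × Fin nbar × Fin s => θ ^ (x.1 : ℕ) * lam x.2.1 x.2.2))
    (hloc : IsLocallyIndependent u s θ lam) (host : Fin nbar) (E : Finset (Fin nbar))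
    (hE : host ∉ E)
    {a : Fin ⌈(nbar : ℚ) / (s : ℚ)⌉₊} {b : Fin s} (ha : rackGroup s host = a)
    (hb : rackPos s host = b) (f : {i : RackLayer nbar s // i a = b} → F[X])
    (hf : ∀ i, (f i).degree < ((s + E.card : ℕ) : WithBot ℕ))
    (hhost : ∀ i e, (f i).eval (lam host e ^ u) = 0)
    (hev : ∀ p ∈ E, ∀ i : {i : RackLayer nbar s // i a = b},
      rackCoeff u lam (extendLayer _ _ f) p i.1 = 0) : f = 0 := by
  have hpow : ∀ (g : Fin u) (y : F), (θ ^ (g : ℕ) * y) ^ u = y ^ u := fun g y => by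
    rw [mul_pow, ← pow_mul, mul_comm (g : ℕ), pow_mul, hθ, one_pow, one_mul]
  let pt : Fin u × Fin nbar × Fin s → F := fun x => θ ^ (x.1 : ℕ) * lam x.2.1 x.2.2
  let D : Finset (Fin nbar × Fin u) := E ×ˢ Finset.univ
  have hDcard : ∀ a', (D.filter fun d => rackGroup s d.1 = a').card =
      (E.filter fun p => rackGroup s p = a').card * u := by
    intro a'
    have : D.filter (fun d => rackGroup s d.1 = a') =
        (E.filter fun p => rackGroup s p = a') ×ˢ Finset.univ := by
      ext d
      simp [D]
    rw [this, Finset.card_product, Finset.card_univ, Fintype.card_fin]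
  -- The points of the host's group: the host contributes the points of all `s` digits. A rack of
  -- `E` in that group contributes only those of the digit `b`, the only ones its coefficients see
  -- in the supporting layers.
  let S : Finset (Fin u × Fin nbar × Fin s) :=
    Finset.univ ×ˢ {host} ×ˢ Finset.univ ∪
      Finset.univ ×ˢ (E.filter fun p => rackGroup s p = a) ×ˢ {b}
  have hS : S.card = s * u + (D.filter fun d => rackGroup s d.1 = a).card := by
    rw [Finset.card_union_of_disjoint, hDcard]
    · simp only [Finset.card_product, Finset.card_univ, Fintype.card_fin, Finset.card_singleton]
      ring
    · rw [Finset.disjoint_left]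
      rintro ⟨g, p, e⟩ h1 h2
      simp only [Finset.mem_product, Finset.mem_singleton, Finset.mem_filter] at h1 h2
      exact hE (h1.2.1 ▸ h2.2.1.1)
  have hSgroup : ∀ x ∈ S, rackGroup s x.2.1 = a := by
    rintro ⟨g, p, e⟩ hx
    simp only [S, Finset.mem_union, Finset.mem_product, Finset.mem_singleton, Finset.mem_filter,
      Finset.mem_univ, true_and, and_true] at hx
    rcases hx with rfl | hx
    · exact ha
    · exact hx.1.2
  -- In the host's group the coupled conditions are replaced by plain vanishing at `S` in each
  -- component, which needs only distinct points. The other groups keep their local conditions.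
  let N : Fin ⌈(nbar : ℚ) / (s : ℚ)⌉₊ → Submodule F[X] (Fin s → F[X]) := fun a' =>
    if a' = a then evalSubmodule (fun γ : {x // x ∈ S} × Fin s => pt γ.1.1)
      (fun γ => Pi.single γ.2 1) else groupEvalSubmodule θ lam D a'
  let δ : Fin ⌈(nbar : ℚ) / (s : ℚ)⌉₊ → ℕ := fun a' =>
    (if a' = a then s * u else 0) + (D.filter fun d => rackGroup s d.1 = a').card
  let M : Fin ⌈(nbar : ℚ) / (s : ℚ)⌉₊ → F[X] := fun a' =>
    if a' = a then ∏ γ : {x // x ∈ S} × Fin s, (X - C (pt γ.1.1))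
    else ∏ γ : {d // d ∈ D.filter fun d => rackGroup s d.1 = a'} × Fin s,
        (X - C (θ ^ (γ.1.1.2 : ℕ) * lam γ.1.1.1 γ.2))
  have hN : ∀ a', IsRemainderModule (N a') (δ a') (M a') := by
    intro a'
    by_cases h : a' = a
    · subst h
      simp only [N, δ, M, if_true]
      rw [← hS]
      refine isRemainderModule_evalSubmodule _ _ _
        (by rw [Fintype.card_prod, Fintype.card_coe, mul_comm]) ?_
      intro v hv hvev
      ext1 e
      refine eq_zero_of_degree_lt_of_eval_index_eq_zero S (v := pt)
        hinj.injOn (hv e) ?_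
      intro x hx
      have := hvev (⟨x, hx⟩, e)
      simpa [Pi.single_apply] using this
    · simp only [N, δ, M, if_neg h, zero_add]
      exact hloc.isRemainderModule D a'
  have hM : ∀ a₁ a₂, a₁ ≠ a₂ → IsCoprime (M a₁) (M a₂) := by
    have key : ∀ a₂, a₂ ≠ a → IsCoprime (M a) (M a₂) := by
      intro a₂ h₂
      simp only [M, if_true, if_neg h₂]
      refine isCoprime_prod_X_sub_C _ _ fun γ γ' h => h₂ ?_
      have h1 := @hinj γ.1.1 (γ'.1.1.2, γ'.1.1.1, γ'.2) h
      rw [← hSgroup _ γ.1.2, h1]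
      exact (Finset.mem_filter.1 γ'.1.2).2.symm
    intro a₁ a₂ h
    by_cases h₁ : a₁ = a
    · subst h₁
      exact key a₂ h.symm
    by_cases h₂ : a₂ = a
    · subst h₂
      exact (key a₁ h).symm
    simp only [M, if_neg h₁, if_neg h₂]
    refine isCoprime_prod_X_sub_C _ _ fun γ γ' hγ => h ?_
    have h3 := @hinj (γ.1.1.2, γ.1.1.1, γ.2) (γ'.1.1.2, γ'.1.1.1, γ'.2) hγ
    rw [← (Finset.mem_filter.1 γ.1.2).2, ← (Finset.mem_filter.1 γ'.1.2).2]
    simp only [Prod.mk.injEq] at h3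
    rw [h3.2.1]
  -- The family is made constant in the digit `a`, so that it is defined on all layers. The degree
  -- bound `u * (s + E.card)` equals the sum of the `δ a'`.
  have hzero : (fun j => expand F u (constLayer a b f j)) = 0 := by
    refine eq_zero_of_digitSlice_mem N δ M hN hM Finset.univ (u * (s + E.card)) _ ?_ ?_ ?_
    · have h1 : ∑ a', (D.filter fun d => rackGroup s d.1 = a').card = D.card :=
        (Finset.card_eq_sum_card_fiberwise fun d _ => Finset.mem_univ _).symm
      simp only [δ, Finset.sum_add_distrib, h1]
      simp only [Finset.sum_ite_eq', Finset.mem_univ, if_true, D, Finset.card_product,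
        Finset.card_univ, Fintype.card_fin]
      exact le_of_eq (by ring)
    · intro i
      have := degree_X_pow_mul_expand_lt (w := 0) hu (r := u * (s + E.card))
        (Nat.add_pos_left (Nat.pos_of_ne_zero (NeZero.ne s)) E.card) (by
          have := Nat.pos_of_ne_zero (NeZero.ne s)
          rw [zero_add]
          exact Nat.mul_lt_mul_of_pos_left (by omega) hu)
        (hf ⟨Function.update i a b, Function.update_self _ _ _⟩)
      simpa [constLayer] using this
    · rintro a' - i
      by_cases h : a' = a
      · subst h
        simp only [N, if_true]
        rintro ⟨⟨⟨g, p, e'⟩, hx⟩, e⟩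
        simp only [Pi.single_apply, ite_mul, one_mul, zero_mul, Finset.sum_ite_eq',
          Finset.mem_univ, if_true, digitSlice, constLayer_update, expand_eval, pt, hpow]
        simp only [S, Finset.mem_union, Finset.mem_product, Finset.mem_singleton,
          Finset.mem_filter, Finset.mem_univ, true_and, and_true] at hx
        rcases hx with rfl | ⟨⟨hp, hpa⟩, rfl⟩
        · exact hhost _ _
        · have h1 := hev p hp ⟨Function.update i a' e', Function.update_self _ _ _⟩
          rw [rackCoeff_same_group lam (hpa.trans ha.symm)
            (fun i hi => extendLayer_eq_zero f (by rwa [ha, hb] at hi))] at h1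
          simp only [ha, hb, Function.update_self, Function.update_idem] at h1
          rw [extendLayer_eq_constLayer f (Function.update_self _ _ _), constLayer_update] at h1
          simpa [kernelCoeff] using h1
      · simp only [N, if_neg h]
        rintro ⟨⟨⟨p, g⟩, hd⟩, e⟩
        obtain rfl := (Finset.mem_filter.1 hd).2
        have hp : p ∈ E := (Finset.mem_product.1 (Finset.mem_filter.1 hd).1).1
        simp only [digitSlice, expand_eval, hpow] at h ⊢
        have h1 := hev p hp ⟨Function.update (Function.update i a b) (rackGroup s p) e, by
          rw [Function.update_of_ne (Ne.symm h), Function.update_self]⟩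
        unfold rackCoeff at h1
        simp only [Function.update_self, Function.update_idem] at h1
        rw [← h1]
        refine Finset.sum_congr rfl fun e' _ => ?_
        rw [extendLayer_eq_constLayer f
          (by rw [Function.update_of_ne (Ne.symm h), Function.update_self]),
          Function.update_comm (Ne.symm h), constLayer_update]
  ext1 ⟨i, hi⟩
  have h1 := congrFun hzero i
  have h2 : constLayer a b f i = f ⟨i, hi⟩ := by
    unfold constLayer
    congr 2
    rw [← hi, Function.update_eq_self]
  rw [← h2]
  exact (expand_eq_zero hu).1 h1

theorem extendLayer_add {R : Type*} [AddMonoid R] {m s : ℕ} (a : Fin m) (b : Fin s)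
    (f g : {i : Fin m → Fin s // i a = b} → R) :
    extendLayer a b (f + g) = extendLayer a b f + extendLayer a b g := by
  ext i
  simp only [extendLayer, Pi.add_apply]
  split_ifs <;> simp

theorem extendLayer_smul {K R : Type*} [Zero R] [SMulZeroClass K R] {m s : ℕ} (a : Fin m)
    (b : Fin s) (c : K) (f : {i : Fin m → Fin s // i a = b} → R) :
    extendLayer a b (c • f) = c • extendLayer a b f := by
  ext i
  simp only [extendLayer, Pi.smul_apply]
  split_ifs <;> simp

theorem rackCoeff_add {F : Type*} [Field F] {nbar s : ℕ} [NeZero s] (u : ℕ)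
    (lam : Fin nbar → Fin s → F) (f g : RackLayer nbar s → F[X]) (p : Fin nbar)
    (j : RackLayer nbar s) :
    rackCoeff u lam (f + g) p j = rackCoeff u lam f p j + rackCoeff u lam g p j := by
  simp [rackCoeff, mul_add, Finset.sum_add_distrib]

theorem rackCoeff_smul {F : Type*} [Field F] {nbar s : ℕ} [NeZero s] (u : ℕ)
    (lam : Fin nbar → Fin s → F) (c : F) (f : RackLayer nbar s → F[X]) (p : Fin nbar)
    (j : RackLayer nbar s) :
    rackCoeff u lam (c • f) p j = c * rackCoeff u lam f p j := by
  simp [rackCoeff, Finset.mul_sum, mul_left_comm]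

/-- A layer is given by its digit at `a` and the layer with that digit replaced by `b`. -/
def layerSplitEquiv {m s : ℕ} (a : Fin m) (b : Fin s) :
    {i : Fin m → Fin s // i a = b} × Fin s ≃ (Fin m → Fin s) where
  toFun x := Function.update x.1.1 a x.2
  invFun j := (⟨Function.update j a b, Function.update_self _ _ _⟩, j a)
  left_inv := by
    rintro ⟨⟨i, hi⟩, e⟩
    simp [← hi]
  right_inv j := by simp

theorem card_layer_mul {m s : ℕ} (a : Fin m) (b : Fin s) :
    Fintype.card {i : Fin m → Fin s // i a = b} * s = s ^ m := by
  have := Fintype.card_congr (layerSplitEquiv a b)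
  simpa only [Fintype.card_prod, Fintype.card_fin, Fintype.card_fun] using this

theorem kernelCoeff_ne_zero (F : Type*) [Field F] {s : ℕ} (b e : Fin s) :
    kernelCoeff F b b e ≠ 0 := by
  unfold kernelCoeff
  split_ifs <;> simp_all

theorem sum_eq_sum_subtype_of_eq_zero {α R : Type*} [Fintype α] [AddCommMonoid R] (P : α → Prop)
    [DecidablePred P] (g : α → R) (hg : ∀ i, ¬ P i → g i = 0) :
    ∑ i, g i = ∑ i : {i // P i}, g i := by
  rw [← Finset.sum_subset (Finset.subset_univ (Finset.univ.filter P))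
    (fun i _ hi => hg i (by simpa using hi))]
  exact Finset.sum_subtype _ (by simp) _

/-- With the helpers' symbols zero, each supporting layer leaves `s` unknown host symbols and one
symbol for each rack of `E`. This matches the `ρ` coefficients of each test polynomial, and
`eq_zero_of_repairConditions` makes the square system nonsingular. -/
theorem rackSymbol_host_eq_zero {F : Type*} [Field F] {nbar u s r : ℕ} [NeZero s] {θ : F}
    {lam : Fin nbar → Fin s → F} (hθ : θ ^ u = 1) (hu : 0 < u)
    (hinj : Function.Injective
      (fun x : Fin u × Fin nbar × Fin s => θ ^ (x.1 : ℕ) * lam x.2.1 x.2.2))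
    (hloc : IsLocallyIndependent u s θ lam)
    {c : Fin nbar × Fin u → RackLayer nbar s → F} (hc : c ∈ coupledLayerCode nbar u s r θ lam)
    (host : Fin nbar) (H : Finset (Fin nbar)) (hH : host ∉ H) {ρ w : ℕ}
    (hρ : ρ + H.card + 1 = s + nbar) (hr : w + u * (ρ - 1) < r)
    (hy : ∀ p ∈ H, ∀ i : RackLayer nbar s, i (rackGroup s host) = rackPos s host →
      rackSymbol θ lam c p i w = 0) (j : RackLayer nbar s) :
    rackSymbol θ lam c host j w = 0 := by
  obtain ⟨a, ha⟩ : ∃ a, rackGroup s host = a := ⟨_, rfl⟩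
  obtain ⟨b, hb⟩ : ∃ b, rackPos s host = b := ⟨_, rfl⟩
  have hs : 0 < s := Nat.pos_of_ne_zero (NeZero.ne s)
  let E : Finset (Fin nbar) := (insert host H)ᶜ
  have hhost : host ∉ E := by simp [E]
  have hcardH : H.card + 1 ≤ nbar := by
    have := Finset.card_le_univ (insert host H)
    rwa [Finset.card_insert_of_notMem hH, Fintype.card_fin] at this
  have hE : s + E.card = ρ := by
    rw [Finset.card_compl, Finset.card_insert_of_notMem hH, Fintype.card_fin]
    omega
  have hρ0 : 0 < ρ := by omega
  let ev : ({i : RackLayer nbar s // i a = b} → degreeLT F ρ) →ₗ[F]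
      ({i : RackLayer nbar s // i a = b} × (Fin s ⊕ {p // p ∈ E})) → F :=
    { toFun := fun f x => Sum.elim (fun e => (f x.1 : F[X]).eval (lam host e ^ u))
        (fun p => rackCoeff u lam (extendLayer a b fun i => (f i : F[X])) p.1 x.1.1) x.2
      map_add' := by
        intro f g
        ext ⟨i, e | p⟩
        · simp
        · exact (congrArg (fun q => rackCoeff u lam q p.1 i.1)
            (extendLayer_add a b (fun i => (f i : F[X])) fun i => (g i : F[X]))).trans
              (rackCoeff_add u lam _ _ _ _)
      map_smul' := by
        intro t f
        ext ⟨i, e | p⟩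
        · simp
        · exact (congrArg (fun q => rackCoeff u lam q p.1 i.1)
            (extendLayer_smul a b t (fun i => (f i : F[X])))).trans
              (rackCoeff_smul u lam _ _ _ _) }
  have hev : Function.Injective ev := by
    rw [injective_iff_map_eq_zero]
    intro f hf
    have := eq_zero_of_repairConditions hθ hu hinj hloc host E hhost ha hb
      (fun i => (f i : F[X])) (fun i => by rw [hE]; exact mem_degreeLT.1 (f i).2)
      (fun i e => congrFun hf (i, Sum.inl e)) (fun p hp i => congrFun hf (i, Sum.inr ⟨p, hp⟩))
    ext1 i
    exact Subtype.ext (congrFun this i)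
  have hY := eq_zero_of_forall_sum_mul_eq_zero ev hev
    (by
      rw [finrank_pi_degreeLT, Fintype.card_prod, Fintype.card_sum, Fintype.card_fin,
        Fintype.card_coe, hE])
    (fun x => Sum.elim
      (fun e => kernelCoeff F b b e * rackSymbol θ lam c host (Function.update x.1.1 a e) w)
      (fun p => rackSymbol θ lam c p.1 x.1.1 w) x.2) (by
      intro f
      have hext : ∀ i : RackLayer nbar s, i (rackGroup s host) ≠ rackPos s host →
          extendLayer a b (fun i => (f i : F[X])) i = 0 := fun i hi =>
        extendLayer_eq_zero _ (by rwa [ha, hb] at hi)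
      have h0 := sum_rackCoeff_mul_rackSymbol hθ hu hc hρ0 hr
        (extendLayer a b fun i => (f i : F[X])) (by
          intro i
          unfold extendLayer
          split_ifs
          · exact mem_degreeLT.1 (f _).2
          · rw [degree_zero]
            exact WithBot.bot_lt_coe _)
      have hother : ∀ p, p ≠ host → ∑ j : RackLayer nbar s,
          rackCoeff u lam (extendLayer a b fun i => (f i : F[X])) p j *
            rackSymbol θ lam c p j w =
          ∑ i : {i : RackLayer nbar s // i a = b},
            rackCoeff u lam (extendLayer a b fun i => (f i : F[X])) p i.1 *
            rackSymbol θ lam c p i.1 w := by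
        intro p hp
        refine sum_eq_sum_subtype_of_eq_zero (fun i : RackLayer nbar s => i a = b) _ ?_
        intro i hi
        rw [rackCoeff_eq_zero lam hp hext (by rwa [ha, hb]), zero_mul]
      have hsplit : (Finset.univ : Finset (Fin nbar)) = insert host (H ∪ E) := by
        ext p
        simp only [E, Finset.mem_univ, Finset.mem_insert, Finset.mem_union, Finset.mem_compl]
        tauto
      rw [hsplit, Finset.sum_insert (by simp [hH, hhost]), Finset.sum_union (by
          rw [Finset.disjoint_left]
          intro p hp hpE
          simp [E, hp] at hpE)] at h0
      have hHsum : ∑ p ∈ H, ∑ j : RackLayer nbar s,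
          rackCoeff u lam (extendLayer a b fun i => (f i : F[X])) p j *
            rackSymbol θ lam c p j w = 0 := by
        refine Finset.sum_eq_zero fun p hp => ?_
        rw [hother p (fun h => hH (h ▸ hp))]
        refine Finset.sum_eq_zero fun i _ => ?_
        rw [hy p hp i.1 (by rw [ha, hb]; exact i.2), mul_zero]
      have hhostsum : ∑ j : RackLayer nbar s,
          rackCoeff u lam (extendLayer a b fun i => (f i : F[X])) host j *
            rackSymbol θ lam c host j w =
          ∑ i : {i : RackLayer nbar s // i a = b}, ∑ e : Fin s,
            (f i : F[X]).eval (lam host e ^ u) *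
              (kernelCoeff F b b e *
                rackSymbol θ lam c host (Function.update i.1 a e) w) := by
        rw [← Equiv.sum_comp (layerSplitEquiv a b), Fintype.sum_prod_type]
        refine Finset.sum_congr rfl fun i _ => Finset.sum_congr rfl fun e _ => ?_
        have hi : (⟨Function.update i.1 a b, Function.update_self _ _ _⟩ :
            {i : RackLayer nbar s // i a = b}) = i :=
          Subtype.ext (Function.update_eq_self_iff.2 i.2.symm)
        rw [rackCoeff_same_group lam rfl hext]
        simp only [ha, hb, layerSplitEquiv, Equiv.coe_fn_mk, Function.update_self,
          Function.update_idem]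
        rw [extendLayer_eq_constLayer _ (Function.update_self _ _ _), constLayer_update]
        simp only [constLayer, hi]
        ring
      rw [hHsum, zero_add, hhostsum, Finset.sum_congr rfl fun p hp =>
        hother p (fun h => hhost (h ▸ hp)), Finset.sum_comm (s := E), ← Finset.sum_add_distrib] at h0
      rw [← h0, Fintype.sum_prod_type]
      refine Finset.sum_congr rfl fun i _ => ?_
      rw [Fintype.sum_sum_type, ← Finset.sum_coe_sort E]
      rfl)
  -- The host unknown at `(i, e)` is the symbol in the layer `i` with its digit changed to `e`, so
  -- every layer `j` is reached. Its factor `kernelCoeff F b b e` is `1` or `-1`.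
  have h1 := congrFun hY (⟨Function.update j a b, Function.update_self _ _ _⟩, Sum.inl (j a))
  simp only [Sum.elim_inl, Function.update_idem, Function.update_eq_self, Pi.zero_apply] at h1
  exact (mul_eq_zero.1 h1).resolve_left (kernelCoeff_ne_zero F b _)

theorem rackSymbol_sub {F : Type*} [Field F] {nbar u s : ℕ} [NeZero s] (θ : F)
    (lam : Fin nbar → Fin s → F) (c c' : Fin nbar × Fin u → RackLayer nbar s → F)
    (p : Fin nbar) (j : RackLayer nbar s) (w : ℕ) :
    rackSymbol θ lam (c - c') p j w = rackSymbol θ lam c p j w - rackSymbol θ lam c' p j w := by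
  simp [rackSymbol, mul_sub]

/-- In each layer the `h` power sums form a Vandermonde system in the `h` failed symbols, at
distinct points. -/
theorem eq_zero_of_rackSymbol_eq_zero {F : Type*} [Field F] {nbar u s h : ℕ} [NeZero s] {θ : F}
    {lam : Fin nbar → Fin s → F}
    (hinj : Function.Injective
      (fun x : Fin u × Fin nbar × Fin s => θ ^ (x.1 : ℕ) * lam x.2.1 x.2.2))
    {c : Fin nbar × Fin u → RackLayer nbar s → F} {host : Fin nbar} {I : Finset (Fin u)}
    (hI : I.card = h) (hc : ∀ g ∉ I, c (host, g) = 0) {j : RackLayer nbar s}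
    (hy : ∀ w < h, rackSymbol θ lam c host j w = 0) (g : Fin u) : c (host, g) j = 0 := by
  by_cases hg : g ∈ I
  · let e := I.equivFinOfCardEq hI
    have := Matrix.eq_zero_of_forall_pow_sum_mul_pow_eq_zero
      (f := fun t => θ ^ ((e.symm t).1 : ℕ) * lam host (j (rackGroup s host)))
      (v := fun t => c (host, (e.symm t).1) j)
      (by
        intro t t' ht
        have := @hinj ((e.symm t).1, host, j (rackGroup s host))
          ((e.symm t').1, host, j (rackGroup s host)) ht
        simp only [Prod.mk.injEq, and_true] at this
        exact e.symm.injective (Subtype.ext this))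
      (by
        intro w
        rw [← hy w w.2, rackSymbol, ← Finset.sum_subset (Finset.subset_univ I) (fun g _ hg => by
          rw [hc g hg, Pi.zero_apply, mul_zero]), ← Finset.sum_coe_sort I,
          ← Equiv.sum_comp e.symm]
        exact Finset.sum_congr rfl fun t _ => mul_comm _ _)
    have h2 := congrFun this (e ⟨g, hg⟩)
    simpa using h2
  · rw [hc g hg, Pi.zero_apply]

/-! ### From vanishing statements to repair schemes -/

/-- The repair scheme in which the rack `p` sends its `w`-th rack symbols, `w ∈ W p`, in all layers
whose digit in the group of the host is the position of the host. -/
theorem exists_rackRepairScheme {F : Type*} [Field F] {nbar u s r : ℕ} [NeZero s] {θ : F}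
    {lam : Fin nbar → Fin s → F} (host : Fin nbar) (I : Finset (Fin u)) (H : Finset (Fin nbar))
    (W : Fin nbar → Finset ℕ)
    (hW : ∀ c ∈ coupledLayerCode nbar u s r θ lam,
      (∀ p ∈ H, ∀ w ∈ W p, ∀ i : RackLayer nbar s, i (rackGroup s host) = rackPos s host →
        rackSymbol θ lam c p i w = 0) →
      (∀ g ∉ I, c (host, g) = 0) → ∀ g ∈ I, c (host, g) = 0) :
    ∃ S : RackRepairScheme (coupledLayerCode nbar u s r θ lam) host I H,
      ∀ j, S.load j * s = (W j.1).card * s ^ ⌈(nbar : ℚ) / (s : ℚ)⌉₊ ∧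
        (S.access j).card * s = u * s ^ ⌈(nbar : ℚ) / (s : ℚ)⌉₊ := by
  classical
  let L' := {i : RackLayer nbar s // i (rackGroup s host) = rackPos s host}
  let C := coupledLayerCode nbar u s r θ lam
  let load : {j // j ∈ H} → ℕ := fun p => Fintype.card ({w // w ∈ W p.1} × L')
  let send : (p : {j // j ∈ H}) → (Fin u → RackLayer nbar s → F) → Fin (load p) → F :=
    fun p x t =>
      let y := (Fintype.equivFin ({w // w ∈ W p.1} × L')).symm t
      ∑ g : Fin u, (θ ^ (g : ℕ) * lam p.1 (y.2.1 (rackGroup s p.1))) ^ y.1.1 * x g y.2.1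
  -- Recovery reads the failed nodes off any codeword consistent with the received data. For data
  -- coming from a codeword one exists, so the default `0` is not used; two of them agree on the
  -- failed nodes by `hW` applied to their difference.
  let IsConsistent : ((p : {j // j ∈ H}) → Fin (load p) → F) → ({g // g ∉ I} → RackLayer nbar s → F) →
      (Fin nbar × Fin u → RackLayer nbar s → F) → Prop := fun m y c =>
    c ∈ C ∧ (fun p : {j // j ∈ H} => send p fun g => c (p.1, g)) = m ∧
      (fun g : {g // g ∉ I} => c (host, g.1)) = y
  refine ⟨{ load := load
            access := fun _ => Finset.univ ×ˢ
              Finset.univ.filter fun i => i (rackGroup s host) = rackPos s host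
            send := send
            send_access := ?_
            recover := fun m y g => if h : ∃ c, IsConsistent m y c then h.choose (host, g.1) else 0
            recover_send := ?_ }, fun p => ⟨?_, ?_⟩⟩
  · intro p x y hxy
    ext t
    refine Finset.sum_congr rfl fun g _ => ?_
    congr 1
    exact hxy (g, _) (by simpa using ((Fintype.equivFin ({w // w ∈ W p.1} × L')).symm t).2.2)
  · intro c hc
    have hex : ∃ c', IsConsistent (fun p => send p fun g => c (p.1, g)) (fun g => c (host, g.1)) c' :=
      ⟨c, hc, rfl, rfl⟩
    ext1 g
    rw [dif_pos hex]
    obtain ⟨hc', hm, hy⟩ := hex.choose_spec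
    rw [← sub_eq_zero]
    refine hW (hex.choose - c) (C.sub_mem hc' hc) ?_ ?_ g.1 g.2
    · intro p hp w hw i hi
      rw [rackSymbol_sub, sub_eq_zero]
      have := congrFun (congrFun hm ⟨p, hp⟩)
        (Fintype.equivFin ({w // w ∈ W p} × L') (⟨w, hw⟩, ⟨i, hi⟩))
      simp only [send, Equiv.symm_apply_apply] at this
      exact this
    · intro g' hg'
      rw [Pi.sub_apply, sub_eq_zero]
      exact congrFun hy ⟨g', hg'⟩
  · show Fintype.card ({w // w ∈ W p.1} × L') * s = _
    rw [Fintype.card_prod, Fintype.card_coe, mul_assoc, card_layer_mul]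
  · show (Finset.card (_ ×ˢ _)) * s = _
    rw [Finset.card_product, Finset.card_univ, Fintype.card_fin, mul_assoc,
      ← Fintype.card_subtype, card_layer_mul]

/-! ### Lower bounds on bandwidth and access -/

/-- Averaging over subsets, done by induction on the size: sum the bound for `A.erase x` over all `x
∈ A`, then cancel `n`. -/
theorem card_mul_le_of_forall_card_eq {α : Type*} [DecidableEq α] (f : α → ℕ) {B s : ℕ}
    (hs : 0 < s) (hf : ∀ A : Finset α, A.card = s → B ≤ ∑ x ∈ A, f x) (n : ℕ) (hn : s ≤ n) :
    ∀ A : Finset α, A.card = n → n * B ≤ s * ∑ x ∈ A, f x := by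
  induction n, hn using Nat.le_induction with
  | base =>
    intro A hA
    exact Nat.mul_le_mul_left _ (hf A hA)
  | succ n hn ih =>
    intro A hA
    have h1 : ∀ x ∈ A, n * B + s * f x ≤ s * ∑ x ∈ A, f x := by
      intro x hx
      have := ih (A.erase x) (by rw [Finset.card_erase_of_mem hx, hA]; rfl)
      rw [← Finset.add_sum_erase A f hx, mul_add]
      omega
    have h2 := Finset.sum_le_sum h1
    rw [Finset.sum_add_distrib, Finset.sum_const, Finset.sum_const, hA, smul_eq_mul, smul_eq_mul,
      ← Finset.mul_sum] at h2
    have h3 : n * ((n + 1) * B) ≤ n * (s * ∑ x ∈ A, f x) := by nlinarith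
    exact Nat.le_of_mul_le_mul_left h3 (by omega)

/-- Restriction to `k` nodes is injective between spaces of equal dimension, so the contents of any
`k` nodes can be prescribed. -/
theorem IsMDSArrayCode.exists_eq_on {F : Type*} [Field F] {nbar u k : ℕ} {L : Type*} [Fintype L]
    {C : RackArrayCode F nbar u L} (hC : IsMDSArrayCode k C) {K : Finset (Fin nbar × Fin u)}
    (hK : K.card = k) (y : Fin nbar × Fin u → L → F) : ∃ c ∈ C, ∀ p ∈ K, c p = y p := by
  let π : C →ₗ[F] ({d // d ∈ K} → L → F) :=
    { toFun := fun c d => c.1 d.1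
      map_add' := fun _ _ => rfl
      map_smul' := fun _ _ => rfl }
  have hπ : Function.Injective π := fun c c' h =>
    Subtype.ext (hC.2 K hK c c.2 c' c'.2 fun p hp => congrFun h ⟨p, hp⟩)
  have hsurj : Function.Surjective π :=
    (LinearMap.injective_iff_surjective_of_finrank_eq_finrank (by
      rw [hC.1, Module.finrank_pi_fintype]
      simp [hK])).1 hπ
  obtain ⟨c, hc⟩ := hsurj fun d => y d.1
  exact ⟨c, c.2, fun p hp => congrFun hc ⟨p, hp⟩⟩

/-- The counting argument behind the cut-set bound: with all helper racks outside `A`, the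
surviving nodes of the host and the nodes `V` of the helper rack `j₀` fixed to zero, the contents
of the failed nodes are arbitrary and determined by the transmissions of the racks in `A`. -/
theorem RackRepairScheme.cutSet {F : Type*} [Field F] [Fintype F] {nbar u kbar v k : ℕ}
    {L : Type*} [Fintype L] {C : RackArrayCode F nbar u L} (hk : k = kbar * u + v)
    (hC : IsMDSArrayCode k C)
    {host : Fin nbar} {I : Finset (Fin u)} {H : Finset (Fin nbar)} (hhost : host ∉ H)
    (S : RackRepairScheme C host I H) (A : Finset {j // j ∈ H}) (hA : Aᶜ.card + 1 = kbar)
    {j₀ : {j // j ∈ H}} (hj₀ : j₀ ∈ A) (V : Finset (Fin u)) (hV : V.card = v) :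
    I.card * Fintype.card L ≤ ∑ j ∈ A, S.load j ∧
      (I.card * Fintype.card L = ∑ j ∈ A, S.load j →
        S.load j₀ ≤ ((S.access j₀).filter fun p => p.1 ∉ V).card) := by
  classical
  have hq : 1 < Fintype.card F := Fintype.one_lt_card
  let T : Finset (Fin nbar) := Aᶜ.map (Function.Embedding.subtype _)
  have hT : ∀ j, j ∈ T ↔ ∃ h : j ∈ H, (⟨j, h⟩ : {j // j ∈ H}) ∉ A := by
    intro j
    simp [T]
  have hhostT : host ∉ T := fun h => hhost ((hT _).1 h).1
  -- These are `kbar` full racks, namely the host and the `kbar - 1` helpers outside `A`, together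
  -- with the `v` nodes `V` of `j₀`: `k` nodes in all.
  let K : Finset (Fin nbar × Fin u) := insert host T ×ˢ Finset.univ ∪ {j₀.1} ×ˢ V
  have hK : K.card = k := by
    rw [Finset.card_union_of_disjoint]
    · rw [Finset.card_product, Finset.card_insert_of_notMem hhostT, Finset.card_map, hA,
        Finset.card_product, hV, Finset.card_univ, Fintype.card_fin, Finset.card_singleton,
        one_mul, hk]
    · rw [Finset.disjoint_left]
      rintro ⟨p, g⟩ h1 h2
      simp only [Finset.mem_product, Finset.mem_singleton, Finset.mem_insert] at h1 h2
      rw [h2.1] at h1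
      rcases h1.1 with h | h
      · exact hhost (h ▸ j₀.2)
      · exact ((hT _).1 h).2 hj₀
  let z : ({g // g ∈ I} → L → F) → Fin nbar × Fin u → L → F := fun y p =>
    if h : p.1 = host ∧ p.2 ∈ I then y ⟨p.2, h.2⟩ else 0
  choose c hc hcK using fun y => hC.exists_eq_on hK (z y)
  have hcT : ∀ y (j : {j // j ∈ H}), j ∉ A → (fun g => c y (j.1, g)) = 0 := by
    intro y j hj
    ext1 g
    have hjT : j.1 ∈ T := (hT _).2 ⟨j.2, hj⟩
    rw [hcK y _ (by simp [K, hjT])]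
    simp only [z]
    rw [dif_neg]
    · rfl
    · rintro ⟨h, -⟩
      exact hhostT (h ▸ hjT)
  have hcI : ∀ y (g : {g // g ∈ I}), c y (host, g.1) = y g := by
    intro y g
    rw [hcK y _ (by simp [K])]
    simp [z]
  have hcI' : ∀ y (g : {g // g ∉ I}), c y (host, g.1) = 0 := by
    intro y g
    rw [hcK y _ (by simp [K])]
    simp [z, g.2]
  have hcV : ∀ y, ∀ g ∈ V, c y (j₀.1, g) = 0 := by
    intro y g hg
    rw [hcK y _ (by simp [K, hg])]
    simp only [z]
    rw [dif_neg]
    rintro ⟨h, -⟩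
    have h : j₀.1 = host := h
    exact hhost (h ▸ j₀.2)
  let msg : ({g // g ∈ I} → L → F) → (j : {j // j ∈ A}) → Fin (S.load j.1) → F := fun y j =>
    S.send j.1 fun g => c y (j.1.1, g)
  have hmsg : Function.Injective msg := by
    intro y y' h
    have hall : (fun j => S.send j fun g => c y (j.1, g)) =
        fun j => S.send j fun g => c y' (j.1, g) := by
      ext1 j
      by_cases hj : j ∈ A
      · exact congrFun h ⟨j, hj⟩
      · rw [hcT y j hj, hcT y' j hj]
    have h1 := S.recover_send (c y) (hc y)
    have h2 := S.recover_send (c y') (hc y')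
    simp only [hcI, hcI'] at h1 h2
    rw [hall] at h1
    exact h1.symm.trans h2
  have hdom : Fintype.card ({g // g ∈ I} → L → F) =
      Fintype.card F ^ (I.card * Fintype.card L) := by
    rw [Fintype.card_fun, Fintype.card_fun, Fintype.card_coe, ← pow_mul, mul_comm]
  have hcod : Fintype.card ((j : {j // j ∈ A}) → Fin (S.load j.1) → F) =
      Fintype.card F ^ ∑ j ∈ A, S.load j := by
    rw [Fintype.card_pi, ← Finset.prod_pow_eq_pow_sum, ← Finset.prod_coe_sort A]
    exact Finset.prod_congr rfl fun j _ => by rw [Fintype.card_fun, Fintype.card_fin]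
  refine ⟨?_, fun heq => ?_⟩
  · have := Fintype.card_le_of_injective msg hmsg
    rwa [hdom, hcod, Nat.pow_le_pow_iff_right hq] at this
  · have hbij : Function.Bijective msg :=
      (Fintype.bijective_iff_injective_and_card msg).2 ⟨hmsg, by rw [hdom, hcod, heq]⟩
    set B := (S.access j₀).filter fun p => p.1 ∉ V with hB
    -- In the case of equality `msg` is bijective, so the rack `j₀` can send every message while its
    -- nodes in `V` are zero. Its message is then a surjective function of the symbols read outside
    -- `V`.
    let φ : ({p // p ∈ B} → F) → Fin (S.load j₀) → F := fun x =>
      S.send j₀ fun g i => if h : (g, i) ∈ B then x ⟨(g, i), h⟩ else 0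
    have hφ : Function.Surjective φ := by
      intro m
      obtain ⟨y, hy⟩ := hbij.2 (Function.update 0 ⟨j₀, hj₀⟩ m)
      have h1 := congrFun hy ⟨j₀, hj₀⟩
      rw [Function.update_self] at h1
      refine ⟨fun p => c y (j₀.1, p.1.1) p.1.2, ?_⟩
      rw [← h1]
      refine S.send_access j₀ _ _ fun p hp => ?_
      by_cases hpV : p.1 ∈ V
      · rw [dif_neg (by simp [hB, hpV]), hcV y _ hpV]
        rfl
      · rw [dif_pos (by simp [hB, hpV, hp])]
    have := Fintype.card_le_of_surjective φ hφ
    rwa [Fintype.card_fun, Fintype.card_fun, Fintype.card_fin, Fintype.card_coe,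
      Nat.pow_le_pow_iff_right hq] at this

/-- Any `s` helper racks together send at least `h * l` symbols, where `l` is the number of layers,
by `cutSet`; averaging over the `s`-subsets gives the bound for all `dbar`. -/
theorem isRackBandwidthLowerBound {F : Type*} [Field F] [Fintype F] {nbar u kbar v k dbar s h : ℕ}
    {L : Type*} [Fintype L] (hv : v < u) (hk : k = kbar * u + v) (hkbar : 1 ≤ kbar)
    (hs : s + kbar = dbar + 1) (hs0 : 0 < s) :
    IsRackBandwidthLowerBound F nbar u L k dbar h
      ((dbar : ℚ) * h * (Fintype.card L : ℕ) / s) := by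
  classical
  intro C hC host I H hI hH hhost S
  obtain ⟨V, -, hV⟩ := Finset.exists_subset_card_eq
    (s := (Finset.univ : Finset (Fin u))) (n := v) (by simpa using hv.le)
  have hcardH : Fintype.card {j // j ∈ H} = dbar := by rw [Fintype.card_coe, hH]
  have key := card_mul_le_of_forall_card_eq S.load (B := I.card * Fintype.card L) hs0 (by
    intro A hA
    obtain ⟨j₀, hj₀⟩ := Finset.card_pos.1 (hA.symm ▸ hs0)
    exact (S.cutSet hk hC hhost A (by rw [Finset.card_compl, hcardH]; omega) hj₀ V hV).1)
    dbar (by omega) Finset.univ (by rw [Finset.card_univ, hcardH])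
  rw [div_le_iff₀ (by exact_mod_cast hs0), RackRepairScheme.bandwidth]
  rw [hI] at key
  have : ((dbar * (h * Fintype.card L) : ℕ) : ℚ) ≤ ((s * ∑ j, S.load j : ℕ) : ℚ) := by
    exact_mod_cast key
  push_cast at this ⊢
  linarith

/-- Equal loads with total `b` make every cut-set inequality an equality. Hence each helper reads at
least its load from any `u - v` of its nodes, and averaging over these sets of nodes gives the
factor `u / (u - v)`. -/
theorem isRackAccessLowerBound {F : Type*} [Field F] [Fintype F] {nbar u kbar v k dbar s h : ℕ}
    {L : Type*} [Fintype L] (hv : v < u) (hk : k = kbar * u + v) (hkbar : 1 ≤ kbar)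
    (hs : s + kbar = dbar + 1) (hs0 : 0 < s) :
    IsRackAccessLowerBound F nbar u L k dbar h
      ((dbar : ℚ) * h * (Fintype.card L : ℕ) / s)
      ((dbar : ℚ) * h * u * (Fintype.card L : ℕ) / (s * ((u : ℚ) - v))) := by
  classical
  intro C hC host I H hI hH hhost S hb hload
  have hcardH : Fintype.card {j // j ∈ H} = dbar := by rw [Fintype.card_coe, hH]
  have hβ : ∀ j, s * S.load j = h * Fintype.card L := by
    intro j
    have h1 : S.bandwidth = dbar * S.load j := by
      rw [RackRepairScheme.bandwidth, Finset.sum_congr rfl fun j' _ => hload j' j,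
        Finset.sum_const, Finset.card_univ, hcardH, smul_eq_mul]
    have hs' : (s : ℚ) ≠ 0 := by exact_mod_cast hs0.ne'
    have hd : (dbar : ℚ) ≠ 0 := by
      have : 0 < dbar := by omega
      exact_mod_cast this.ne'
    rw [h1, eq_div_iff hs'] at hb
    have h2 : (dbar : ℚ) * (s * S.load j) = dbar * (h * Fintype.card L) := by
      push_cast at hb
      linarith
    exact_mod_cast mul_left_cancel₀ hd h2
  have hacc : ∀ j, u * S.load j ≤ (u - v) * (S.access j).card := by
    intro j
    have hfib : ∀ A : Finset (Fin u), ∑ g ∈ A, ((S.access j).filter fun p => p.1 = g).card =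
        ((S.access j).filter fun p => p.1 ∈ A).card := by
      intro A
      rw [Finset.card_eq_sum_card_fiberwise (s := (S.access j).filter fun p => p.1 ∈ A) (f := Prod.fst)
        (t := A) (fun p hp => (Finset.mem_filter.1 hp).2)]
      refine Finset.sum_congr rfl fun g hg => ?_
      congr 1
      ext p
      simp only [Finset.mem_filter]
      constructor
      · rintro ⟨h1, rfl⟩
        exact ⟨⟨h1, hg⟩, rfl⟩
      · rintro ⟨⟨h1, -⟩, h2⟩
        exact ⟨h1, h2⟩
    have key := card_mul_le_of_forall_card_eq
      (fun g => ((S.access j).filter fun p => p.1 = g).card) (B := S.load j)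
      (s := u - v) (by omega) (by
        intro A hA
        rw [hfib]
        obtain ⟨A', hjA', -, hA'⟩ := Finset.exists_subsuperset_card_eq
          (Finset.subset_univ {j}) (n := s) (by rw [Finset.card_singleton]; omega)
          (by rw [Finset.card_univ, hcardH]; omega)
        have := (S.cutSet hk hC hhost A' (by rw [Finset.card_compl, hcardH]; omega)
          (hjA' (Finset.mem_singleton_self j)) Aᶜ
          (by rw [Finset.card_compl, hA, Fintype.card_fin]; omega)).2 (by
            rw [Finset.sum_congr rfl fun j' _ => hload j' j, Finset.sum_const, hA',
              smul_eq_mul, hβ, hI])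
        simpa using this)
      u (by omega) Finset.univ (by simp)
    rw [hfib] at key
    simpa using key
  have huv : (0 : ℚ) < (u : ℚ) - v := by
    have : (v : ℚ) < u := by exact_mod_cast hv
    linarith
  have hs' : (0 : ℚ) < s := by exact_mod_cast hs0
  rw [div_le_iff₀ (by positivity), RackRepairScheme.accessed]
  have h1 : ∀ j, (h : ℚ) * u * Fintype.card L ≤ (S.access j).card * (s * ((u : ℚ) - v)) := by
    intro j
    have h2 : ((u * S.load j : ℕ) : ℚ) ≤ (((u - v) * (S.access j).card : ℕ) : ℚ) := by
      exact_mod_cast hacc j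
    have h3 : ((s * S.load j : ℕ) : ℚ) = ((h * Fintype.card L : ℕ) : ℚ) := by
      exact_mod_cast hβ j
    push_cast [Nat.cast_sub hv.le] at h2 h3
    nlinarith
  have h4 := Finset.sum_le_sum fun j (_ : j ∈ (Finset.univ : Finset {j // j ∈ H})) => h1 j
  rw [Finset.sum_const, Finset.card_univ, hcardH, ← Finset.sum_mul, nsmul_eq_mul] at h4
  push_cast
  linarith

/-! ### Choosing the evaluation points -/

theorem MvPolynomial.degreeOf_det_le {σ n R : Type*} [CommRing R] [Fintype n]
    [DecidableEq n] (x : σ) (M : Matrix n n (MvPolynomial σ R)) (w : n → ℕ)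
    (hM : ∀ i j, (M i j).degreeOf x ≤ w j) : M.det.degreeOf x ≤ ∑ j, w j := by
  rw [Matrix.det_apply']
  refine (MvPolynomial.degreeOf_sum_le _ _ _).trans (Finset.sup_le fun τ _ => ?_)
  refine (MvPolynomial.degreeOf_mul_le _ _ _).trans ?_
  have h1 : (((Equiv.Perm.sign τ : ℤˣ) : ℤ) : MvPolynomial σ R).degreeOf x = 0 := by
    rw [← map_intCast (MvPolynomial.C : R →+* MvPolynomial σ R), MvPolynomial.degreeOf_C]
  rw [h1, zero_add]
  exact (MvPolynomial.degreeOf_prod_le _ _ _).trans (Finset.sum_le_sum fun j _ => hM _ _)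

theorem MvPolynomial.exists_eval_ne_zero {σ F : Type*} [Field F] [Fintype F] [Finite σ]
    {P : MvPolynomial σ F} (hP : P ≠ 0) (hdeg : ∀ x, P.degreeOf x < Fintype.card F) :
    ∃ y : σ → F, MvPolynomial.aeval y P ≠ 0 := by
  by_contra! h
  refine hP (MvPolynomial.eq_zero_of_eval_zero_at_prod_finset P (fun _ => Finset.univ) hdeg
    fun y _ => ?_)
  rw [← MvPolynomial.aeval_eq_eval]
  exact h y

/-- The parity-check submatrix of the nodes `D` of one group, at the evaluation points `y`. -/
noncomputable def localMatrix {F R : Type*} [Field F] [CommRing R] [Algebra F R]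
    {nbar u s : ℕ} [NeZero s]
    (θ : F) (y : Fin nbar × Fin s → R) (D : Finset (Fin nbar × Fin u)) :
    Matrix ({d // d ∈ D} × Fin s) ({d // d ∈ D} × Fin s) R := fun i j =>
  algebraMap F R (kernelCoeff F (rackPos s j.1.1.1) i.2 j.2) *
    (algebraMap F R (θ ^ (j.1.1.2 : ℕ)) * y (j.1.1.1, j.2)) ^ (D.equivFin i.1 : ℕ)

theorem aeval_det_localMatrix {F : Type*} [Field F] {nbar u s : ℕ} [NeZero s]
    (θ : F) (y : Fin nbar × Fin s → F) (D : Finset (Fin nbar × Fin u)) :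
    MvPolynomial.aeval y (localMatrix θ (MvPolynomial.X (R := F)) D).det =
      (localMatrix θ y D).det := by
  rw [AlgHom.map_det]
  congr 1
  ext i j
  simp [localMatrix, MvPolynomial.algebraMap_eq]

/-- To make the matrix square, its rows are indexed by `D × Fin s`, and `D.equivFin` translates an
element of `D` into an exponent below `D.card`. A left vector is thus the list of coefficients of a
family of polynomials. -/
theorem sum_coeff_mul_localMatrix {F : Type*} [Field F] {nbar u s : ℕ} [NeZero s]
    (θ : F) (y : Fin nbar × Fin s → F) (D : Finset (Fin nbar × Fin u)) (v : Fin s → F[X])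
    (hv : ∀ e, (v e).degree < D.card) (d : {d // d ∈ D}) (e : Fin s) :
    Matrix.vecMul (fun i : {d // d ∈ D} × Fin s => (v i.2).coeff (D.equivFin i.1))
      (localMatrix θ y D) (d, e) = ∑ e', kernelCoeff F (rackPos s d.1.1) e' e *
        (v e').eval (θ ^ (d.1.2 : ℕ) * y (d.1.1, e)) := by
  rw [Matrix.vecMul, dotProduct, Fintype.sum_prod_type_right]
  refine Finset.sum_congr rfl fun e' _ => ?_
  rw [eval_eq_sum_degreeLTEquiv (mem_degreeLT.2 (hv e')), Finset.mul_sum,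
    ← Equiv.sum_comp D.equivFin]
  refine Finset.sum_congr rfl fun d' _ => ?_
  simp only [degreeLTEquiv, LinearEquiv.coe_mk, localMatrix, Algebra.algebraMap_self,
    RingHom.id_apply]
  show _ = _ * ((v e').coeff (D.equivFin d') * _)
  ring

theorem det_localMatrix_ne_zero_iff {F : Type*} [Field F] {nbar u s : ℕ} [NeZero s]
    (θ : F) (y : Fin nbar × Fin s → F) (D : Finset (Fin nbar × Fin u)) :
    (localMatrix θ y D).det ≠ 0 ↔ ∀ v : Fin s → F[X], (∀ e, (v e).degree < D.card) →
      (∀ d ∈ D, ∀ e, ∑ e', kernelCoeff F (rackPos s d.1) e' e *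
        (v e').eval (θ ^ (d.2 : ℕ) * y (d.1, e)) = 0) → v = 0 := by
  constructor
  · intro hdet v hv hev
    have h1 := Matrix.eq_zero_of_vecMul_eq_zero hdet
      (v := fun i : {d // d ∈ D} × Fin s => (v i.2).coeff (D.equivFin i.1)) (by
        ext ⟨d, e⟩
        rw [sum_coeff_mul_localMatrix θ y D v hv]
        exact hev d.1 d.2 e)
    ext e m
    rcases lt_or_ge m D.card with hm | hm
    · simpa using congrFun h1 (D.equivFin.symm ⟨m, hm⟩, e)
    · exact (degree_lt_iff_coeff_zero _ _).1 (hv e) m hm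
  · intro h hdet
    obtain ⟨V, hV, hVM⟩ := Matrix.exists_vecMul_eq_zero_iff.2 hdet
    let v : Fin s → F[X] := fun e =>
      ((degreeLTEquiv F D.card).symm fun t => V (D.equivFin.symm t, e) : F[X])
    have hvdeg : ∀ e, (v e).degree < D.card := fun e => mem_degreeLT.1 (Subtype.prop _)
    have hvV : (fun i : {d // d ∈ D} × Fin s => (v i.2).coeff (D.equivFin i.1)) = V := by
      ext ⟨d, e⟩
      have h1 : degreeLTEquiv F D.card ((degreeLTEquiv F D.card).symm
          fun t => V (D.equivFin.symm t, e)) (D.equivFin d) = V (d, e) := by simp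
      exact h1
    have hv0 := h v hvdeg fun d hd e => by
      have h1 := sum_coeff_mul_localMatrix θ y D v hvdeg ⟨d, hd⟩ e
      rw [hvV, hVM] at h1
      exact h1.symm
    refine hV ?_
    rw [← hvV, hv0]
    ext i
    simp

/-- The variable of `(p, e)` occurs only in the columns of the nodes of rack `p` with digit `e`, one
for each such node in `D`, with exponents at most `D.card - 1`. -/
theorem degreeOf_det_localMatrix_le {F : Type*} [Field F] {nbar u s : ℕ} [NeZero s]
    (θ : F) (D : Finset (Fin nbar × Fin u)) (x : Fin nbar × Fin s) :
    (localMatrix θ (MvPolynomial.X (R := F)) D).det.degreeOf x ≤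
      (D.filter fun d => d.1 = x.1).card * (D.card - 1) := by
  refine (MvPolynomial.degreeOf_det_le x _
    (fun j => if (j.1.1.1, j.2) = x then D.card - 1 else 0) ?_).trans (le_of_eq ?_)
  · intro i j
    unfold localMatrix
    rw [MvPolynomial.algebraMap_eq]
    refine (MvPolynomial.degreeOf_C_mul_le _ _ _).trans ?_
    refine (MvPolynomial.degreeOf_pow_le _ _ _).trans ?_
    have h1 := MvPolynomial.degreeOf_C_mul_le (MvPolynomial.X (R := F) (j.1.1.1, j.2)) x
      (θ ^ (j.1.1.2 : ℕ))
    rw [MvPolynomial.degreeOf_X] at h1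
    have h2 := (D.equivFin i.1).2
    by_cases hx : x = (j.1.1.1, j.2)
    · rw [if_pos hx] at h1
      rw [if_pos hx.symm]
      calc _ ≤ (D.equivFin i.1 : ℕ) * 1 := Nat.mul_le_mul_left _ h1
        _ ≤ _ := by omega
    · rw [if_neg hx, Nat.le_zero] at h1
      rw [h1, mul_zero]
      exact Nat.zero_le _
  · rw [Fintype.sum_prod_type]
    obtain ⟨p, e₀⟩ := x
    simp only [Prod.mk.injEq, ite_and, Finset.sum_ite_irrel, Finset.sum_ite_eq',
      Finset.mem_univ, if_true, Finset.sum_const_zero]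
    rw [Finset.sum_coe_sort D (fun d => if d.1 = p then D.card - 1 else 0), ← Finset.sum_filter,
      Finset.sum_const, smul_eq_mul]

/-- Specialise the variables of each rack to one value independent of the digit. All conditions of a
node are then at the same point and uncouple, so each `v e` vanishes at `D.card` distinct points. -/
theorem det_localMatrix_X_ne_zero {F : Type*} [Field F] {nbar u s : ℕ} [NeZero s]
    {θ : F} {y : Fin nbar → F}
    (hy : Function.Injective fun d : Fin nbar × Fin u => θ ^ (d.2 : ℕ) * y d.1)
    (D : Finset (Fin nbar × Fin u)) :
    (localMatrix (s := s) θ (MvPolynomial.X (R := F)) D).det ≠ 0 := by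
  intro h
  have h1 := aeval_det_localMatrix θ (fun x : Fin nbar × Fin s => y x.1) D
  rw [h, map_zero] at h1
  refine (det_localMatrix_ne_zero_iff θ (fun x : Fin nbar × Fin s => y x.1) D).2 ?_ h1.symm
  intro v hv hev
  ext1 e
  refine eq_zero_of_degree_lt_of_eval_index_eq_zero D hy.injOn (hv e) fun d hd => ?_
  -- The condition at the rack's own position contains no coupling term; it removes that term from
  -- the other conditions.
  have hb := hev d hd (rackPos s d.1)
  have he := hev d hd e
  rw [sum_kernelCoeff_mul (rackPos s d.1) _ fun e' => (v e').eval _] at hb he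
  rw [if_pos rfl, sub_zero] at hb
  simp only [hb, ite_self, sub_zero] at he
  exact he

/-- Distinct `u`-th powers put the `lam p e` in different cosets of the group generated by `θ`; for
nonzero `lam p e` this makes all `θ ^ g * lam p e` distinct. -/
theorem MvPolynomial.det_vandermonde_X_pow_ne_zero {σ F : Type*} [Field F] [Fintype σ] {u : ℕ}
    (hu : 0 < u) :
    (Matrix.vandermonde fun t => (MvPolynomial.X ((Fintype.equivFin σ).symm t) :
      MvPolynomial σ F) ^ u).det ≠ 0 := by
  classical
  rw [Matrix.det_vandermonde_ne_zero_iff]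
  intro t t' h
  by_contra hne
  have h1 := congrArg (MvPolynomial.aeval (Pi.single ((Fintype.equivFin σ).symm t) (1 : F))) h
  have h2 : (Fintype.equivFin σ).symm t' ≠ (Fintype.equivFin σ).symm t := fun h =>
    hne ((Fintype.equivFin σ).symm.injective h).symm
  simp [Pi.single_eq_of_ne h2, hu.ne'] at h1

theorem MvPolynomial.degreeOf_det_vandermonde_X_pow_le {σ F : Type*} [Field F] [Fintype σ]
    (u : ℕ) (x : σ) :
    (Matrix.vandermonde fun t => (MvPolynomial.X ((Fintype.equivFin σ).symm t) :
      MvPolynomial σ F) ^ u).det.degreeOf x ≤ u * (Fintype.card σ - 1) := by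
  classical
  rw [← Matrix.det_transpose]
  refine (MvPolynomial.degreeOf_det_le x _
    (fun t => if t = Fintype.equivFin σ x then u * (Fintype.card σ - 1) else 0) ?_).trans
    (by simp)
  intro i j
  rw [Matrix.transpose_apply, Matrix.vandermonde_apply, ← pow_mul]
  refine (MvPolynomial.degreeOf_pow_le _ _ _).trans ?_
  rw [MvPolynomial.degreeOf_X]
  have h2 := i.2
  by_cases hx : x = (Fintype.equivFin σ).symm j
  · subst hx
    simp only [if_true, Equiv.apply_symm_apply, mul_one]
    exact Nat.mul_le_mul_left _ (by omega)
  · rw [if_neg hx, mul_zero]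
    exact Nat.zero_le _

/-- With `γ` a generator of the unit group and `m` the quotient of its order by `u`, take `θ = γ ^
m` and `y p = γ ^ p`. The exponents `m * g + p` are distinct and less than the order, since `p <
nbar ≤ m`. -/
theorem exists_orderOf_eq_of_dvd {F : Type*} [Field F] [Fintype F] {nbar u : ℕ} (hu : 0 < u)
    (hdvd : u ∣ Fintype.card F - 1) (hle : nbar * u ≤ Fintype.card F - 1) :
    ∃ (θ : F) (y : Fin nbar → F), orderOf θ = u ∧
      Function.Injective fun d : Fin nbar × Fin u => θ ^ (d.2 : ℕ) * y d.1 := by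
  classical
  obtain ⟨m, hm⟩ := hdvd
  obtain ⟨γ, hγ⟩ := IsCyclic.exists_generator (α := Fˣ)
  have hord : orderOf γ = u * m := by
    rw [orderOf_eq_card_of_forall_mem_zpowers hγ, Nat.card_eq_fintype_card, Fintype.card_units, hm]
  have hpos : 0 < u * m := hord ▸ orderOf_pos γ
  have hm0 : 0 < m := Nat.pos_of_mul_pos_left hpos
  have hnm : nbar ≤ m := by
    rw [hm, mul_comm nbar] at hle
    exact Nat.le_of_mul_le_mul_left hle hu
  refine ⟨((γ ^ m : Fˣ) : F), fun p => ((γ ^ (p : ℕ) : Fˣ) : F), ?_, ?_⟩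
  · rw [orderOf_units, orderOf_pow_of_dvd hm0.ne' (hord ▸ Dvd.intro_left u rfl), hord,
      Nat.mul_div_cancel _ hm0]
  · rintro ⟨p, g⟩ ⟨p', g'⟩ h
    have h1 : γ ^ (m * g.1 + p.1) = γ ^ (m * g'.1 + p'.1) := by
      apply Units.ext
      simpa [pow_add, pow_mul] using h
    have hlt : ∀ (g : Fin u) (p : Fin nbar), m * g.1 + p.1 < orderOf γ := by
      intro g p
      rw [hord]
      have h1 : m * (g.1 + 1) ≤ m * u := Nat.mul_le_mul_left _ g.2
      have := p.2
      rw [mul_comm u]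
      linarith
    have h2 : m * g.1 + p.1 = m * g'.1 + p'.1 := pow_injOn_Iio_orderOf (hlt g p) (hlt g' p') h1
    have hp := p.2
    have hp' := p'.2
    have h3 := congrArg (· % m) h2
    have h4 := congrArg (· / m) h2
    simp only [Nat.mul_add_mod, Nat.mul_add_div hm0, Nat.mod_eq_of_lt (hp.trans_le hnm),
      Nat.mod_eq_of_lt (hp'.trans_le hnm), Nat.div_eq_of_lt (hp.trans_le hnm),
      Nat.div_eq_of_lt (hp'.trans_le hnm), add_zero] at h3 h4
    exact Prod.ext (Fin.ext h3) (Fin.ext h4)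

theorem choose_mul_degree_le_rackOmega_term {u t δ : ℕ} (ht : 1 ≤ t) (hδ : t ≤ δ) (hδu : δ ≤ u * t) :
    (((u * t).choose δ * ((δ + 1 - t) * (δ - 1)) : ℕ) : ℚ) ≤
      u * (1 / 2 : ℚ) * (((u * t).choose δ : ℚ) * ((δ - 1).choose (t - 1) : ℚ) *
        ((δ : ℚ) - t + 1) * ((δ : ℚ) + t - 2)) := by
  have hu : 1 ≤ u := by
    rcases Nat.eq_zero_or_pos u with rfl | h
    · omega
    · exact h
  have h1 : (1 : ℚ) ≤ ((δ - 1).choose (t - 1) : ℚ) := by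
    exact_mod_cast Nat.choose_pos (by omega)
  have htq : (1 : ℚ) ≤ t := by exact_mod_cast ht
  have hδq : (t : ℚ) ≤ δ := by exact_mod_cast hδ
  have h2 : ((δ : ℚ) - t + 1) * ((δ : ℚ) - 1) ≤
      u * (1 / 2 : ℚ) * (((δ : ℚ) - t + 1) * ((δ : ℚ) + t - 2)) := by
    -- For `u = 1` the range of `δ` is the single value `t`, and both sides agree. For `u ≥ 2` the
    -- factor `u / 2` is at least one and `δ - 1 ≤ δ + t - 2`.
    rcases hu.eq_or_lt with rfl | hu2
    · have : δ = t := by omega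
      subst this
      apply le_of_eq
      push_cast
      ring
    · have hu2q : (2 : ℚ) ≤ u := by exact_mod_cast hu2
      have h3 : 0 ≤ ((δ : ℚ) - t + 1) * ((δ : ℚ) + t - 2) :=
        mul_nonneg (by linarith) (by linarith)
      have h4 : ((δ : ℚ) - t + 1) * ((δ : ℚ) - 1) ≤ ((δ : ℚ) - t + 1) * ((δ : ℚ) + t - 2) :=
        mul_le_mul_of_nonneg_left (by linarith) (by linarith)
      nlinarith
  have h5 : 0 ≤ u * (1 / 2 : ℚ) * (((δ : ℚ) - t + 1) * ((δ : ℚ) + t - 2)) :=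
    mul_nonneg (by positivity) (mul_nonneg (by linarith) (by linarith))
  have h6 := mul_le_mul_of_nonneg_right h1 h5
  push_cast [Nat.cast_sub (show t ≤ δ + 1 by omega), Nat.cast_sub (show 1 ≤ δ by omega)]
  calc ((u * t).choose δ : ℚ) * (((δ : ℚ) + 1 - t) * (δ - 1))
      = ((u * t).choose δ : ℚ) * (((δ : ℚ) - t + 1) * (δ - 1)) := by ring
    _ ≤ ((u * t).choose δ : ℚ) * (((δ - 1).choose (t - 1) : ℚ) *
        (u * (1 / 2 : ℚ) * (((δ : ℚ) - t + 1) * ((δ : ℚ) + t - 2)))) :=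
        mul_le_mul_of_nonneg_left (by linarith) (by positivity)
    _ = _ := by ring

theorem sum_choose_mul_degree_le_rackOmega (s u : ℕ) :
    ((∑ t ∈ Finset.Icc 1 s, (s - 1).choose (t - 1) * ∑ δ ∈ Finset.Icc t (u * t),
      (u * t).choose δ * ((δ + 1 - t) * (δ - 1)) : ℕ) : ℚ) ≤ u * rackOmega s u := by
  unfold rackOmega
  rw [← mul_assoc, Nat.cast_sum, Finset.mul_sum]
  refine Finset.sum_le_sum fun t ht => ?_
  rw [Nat.cast_mul, Nat.cast_sum, Finset.mul_sum, Finset.mul_sum]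
  refine Finset.sum_le_sum fun δ hδ => ?_
  rw [Finset.mem_Icc] at ht hδ
  refine (mul_le_mul_of_nonneg_left (choose_mul_degree_le_rackOmega_term ht.1 hδ.1 hδ.2)
    (Nat.cast_nonneg _)).trans (le_of_eq ?_)
  ring

/-- A set `D` of `δ` nodes meeting exactly the racks of `T` has a node in each of the other `T.card
- 1` racks, hence at most `δ + 1 - T.card` in rack `p`. The sets of size `δ` are bounded by all
`δ`-subsets of `T × Fin u`. -/
theorem sum_powersetCard_degree_le {α : Type*} [DecidableEq α] {u : ℕ} (p : α) (T : Finset α)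
    (hp : p ∈ T) (𝒟 : Finset (Finset (α × Fin u)))
    (h𝒟 : ∀ D ∈ 𝒟, D.image Prod.fst = T) :
    ∑ D ∈ 𝒟, (D.filter fun d => d.1 = p).card * (D.card - 1) ≤
      ∑ δ ∈ Finset.Icc T.card (u * T.card),
        (u * T.card).choose δ * ((δ + 1 - T.card) * (δ - 1)) := by
  have hsub : ∀ D ∈ 𝒟, D ⊆ T ×ˢ Finset.univ := by
    intro D hD d hd
    rw [Finset.mem_product, ← h𝒟 D hD]
    exact ⟨Finset.mem_image_of_mem _ hd, Finset.mem_univ _⟩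
  have hprod : (T ×ˢ (Finset.univ : Finset (Fin u))).card = u * T.card := by
    rw [Finset.card_product, Finset.card_univ, Fintype.card_fin, mul_comm]
  rw [← Finset.sum_fiberwise_of_maps_to (g := Finset.card)
    (t := Finset.Icc T.card (u * T.card))]
  · refine Finset.sum_le_sum fun δ _ => ?_
    calc _ ≤ ∑ D ∈ 𝒟.filter fun D => D.card = δ, (δ + 1 - T.card) * (δ - 1) := by
          refine Finset.sum_le_sum fun D hD => ?_
          obtain ⟨hD', rfl⟩ := Finset.mem_filter.1 hD
          refine Nat.mul_le_mul_right _ ?_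
          have h1 := Finset.card_filter_add_card_filter_not (s := D) (fun d => d.1 = p)
          have h2 : T.erase p ⊆ (D.filter fun d => ¬ d.1 = p).image Prod.fst := by
            intro q hq
            obtain ⟨hqp, hq⟩ := Finset.mem_erase.1 hq
            rw [← h𝒟 D hD'] at hq
            obtain ⟨d, hd, rfl⟩ := Finset.mem_image.1 hq
            exact Finset.mem_image_of_mem _ (Finset.mem_filter.2 ⟨hd, hqp⟩)
          have h3 := (Finset.card_le_card h2).trans Finset.card_image_le
          rw [Finset.card_erase_of_mem hp] at h3
          have h4 := Finset.card_pos.2 ⟨p, hp⟩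
          omega
      _ ≤ _ := by
          rw [Finset.sum_const, smul_eq_mul]
          refine Nat.mul_le_mul_right _ ?_
          rw [← hprod, ← Finset.card_powersetCard]
          refine Finset.card_le_card fun D hD => ?_
          obtain ⟨hD, hδ⟩ := Finset.mem_filter.1 hD
          exact Finset.mem_powersetCard.2 ⟨hsub D hD, hδ⟩
  · intro D hD
    rw [Finset.mem_Icc, ← hprod]
    refine ⟨?_, Finset.card_le_card (hsub D hD)⟩
    conv_lhs => rw [← h𝒟 D hD]
    exact Finset.card_image_le

/-- Sets of nodes avoiding rack `p` contribute nothing. The others are sorted by the set of further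
racks they meet, and there are at most `(s - 1).choose (t - 1)` such sets of size `t - 1`. -/
theorem sum_degree_le {α : Type*} [DecidableEq α] {u s : ℕ} (p : α) (G : Finset α) (hp : p ∈ G)
    (hG : G.card ≤ s) (𝒟 : Finset (Finset (α × Fin u)))
    (h𝒟 : ∀ D ∈ 𝒟, p ∈ D.image Prod.fst → D.image Prod.fst ⊆ G) :
    ∑ D ∈ 𝒟, (D.filter fun d => d.1 = p).card * (D.card - 1) ≤
      ∑ t ∈ Finset.Icc 1 s, (s - 1).choose (t - 1) * ∑ δ ∈ Finset.Icc t (u * t),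
        (u * t).choose δ * ((δ + 1 - t) * (δ - 1)) := by
  let B : ℕ → ℕ := fun t => ∑ δ ∈ Finset.Icc t (u * t), (u * t).choose δ * ((δ + 1 - t) * (δ - 1))
  have hcard : (G.erase p).card + 1 ≤ s := by
    rw [Finset.card_erase_of_mem hp]
    have := Finset.card_pos.2 ⟨p, hp⟩
    omega
  calc ∑ D ∈ 𝒟, (D.filter fun d => d.1 = p).card * (D.card - 1)
      = ∑ D ∈ 𝒟.filter fun D => p ∈ D.image Prod.fst,
          (D.filter fun d => d.1 = p).card * (D.card - 1) := by
        symm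
        refine Finset.sum_filter_of_ne fun D _ hne => ?_
        have h1 : (D.filter fun d => d.1 = p).card ≠ 0 := fun h => hne (by rw [h, zero_mul])
        obtain ⟨d, hd⟩ := Finset.card_pos.1 (Nat.pos_of_ne_zero h1)
        exact Finset.mem_image.2 ⟨d, Finset.mem_filter.1 hd⟩
    _ = ∑ T ∈ (G.erase p).powerset, ∑ D ∈ (𝒟.filter fun D => p ∈ D.image Prod.fst).filter
          fun D => (D.image Prod.fst).erase p = T,
          (D.filter fun d => d.1 = p).card * (D.card - 1) := by
        symm
        refine Finset.sum_fiberwise_of_maps_to (fun D hD => ?_) _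
        obtain ⟨hD, hpD⟩ := Finset.mem_filter.1 hD
        exact Finset.mem_powerset.2 (Finset.erase_subset_erase _ (h𝒟 D hD hpD))
    _ ≤ ∑ T ∈ (G.erase p).powerset, B (T.card + 1) := by
        refine Finset.sum_le_sum fun T hT => ?_
        have hpT : p ∉ T := fun h => Finset.notMem_erase p G (Finset.mem_powerset.1 hT h)
        have := sum_powersetCard_degree_le p (insert p T) (Finset.mem_insert_self _ _)
          ((𝒟.filter fun D => p ∈ D.image Prod.fst).filter
            fun D => (D.image Prod.fst).erase p = T) (by
              intro D hD
              obtain ⟨hD', rfl⟩ := Finset.mem_filter.1 hD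
              rw [Finset.insert_erase (Finset.mem_filter.1 hD').2])
        rwa [Finset.card_insert_of_notMem hpT] at this
    _ = ∑ t ∈ Finset.range ((G.erase p).card + 1), (G.erase p).card.choose t • B (t + 1) :=
        Finset.sum_powerset_apply_card fun t => B (t + 1)
    _ ≤ ∑ t ∈ Finset.range s, (s - 1).choose t * B (t + 1) :=
        (Finset.sum_le_sum fun t _ => Nat.mul_le_mul_right _
          (Nat.choose_le_choose t (by omega))).trans
          (Finset.sum_le_sum_of_subset (Finset.range_subset_range.2 hcard))
    _ = _ := by
        refine Finset.sum_nbij' (· + 1) (· - 1) ?_ ?_ ?_ ?_ ?_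
        · intro t ht
          rw [Finset.mem_range] at ht
          exact Finset.mem_Icc.2 ⟨by omega, by omega⟩
        · intro t ht
          rw [Finset.mem_Icc] at ht
          exact Finset.mem_range.2 (by omega)
        · intro t _
          rfl
        · intro t ht
          exact Nat.sub_add_cancel (Finset.mem_Icc.1 ht).1
        · intro t _
          rfl

theorem card_rackGroup_le {nbar s : ℕ} [NeZero s] (a : Fin ⌈(nbar : ℚ) / (s : ℚ)⌉₊) :
    (Finset.univ.filter fun p : Fin nbar => rackGroup s p = a).card ≤ s := by
  have := Finset.card_le_card_of_injOn (s := Finset.univ.filter fun p : Fin nbar =>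
    rackGroup s p = a) (t := (Finset.univ : Finset (Fin s))) (rackPos s) (by simp) (by
      intro p hp q hq h
      exact rack_ext ((Finset.mem_filter.1 hp).2.trans (Finset.mem_filter.1 hq).2.symm) h)
  simpa using this

theorem exists_isLocallyIndependent {F : Type*} [Field F] [Fintype F] {nbar u s : ℕ} [NeZero s]
    (hu : 0 < u) (hnbar : 0 < nbar) (hs : 2 ≤ s) (hdvd : u ∣ Fintype.card F - 1)
    (hq : (nbar : ℚ) * u * s + u * (rackOmega s u + ((s : ℚ) - 1) * 2 ^ (s - 2)) ≤
      Fintype.card F) :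
    ∃ (θ : F) (lam : Fin nbar → Fin s → F), orderOf θ = u ∧
      Function.Injective (fun x : Fin u × Fin nbar × Fin s => θ ^ (x.1 : ℕ) * lam x.2.1 x.2.2) ∧
      IsLocallyIndependent u s θ lam := by
  classical
  have hcount := sum_choose_mul_degree_le_rackOmega s u
  set Z : ℕ := ∑ t ∈ Finset.Icc 1 s, (s - 1).choose (t - 1) * ∑ δ ∈ Finset.Icc t (u * t),
      (u * t).choose δ * ((δ + 1 - t) * (δ - 1)) with hZ
  have hbudget : nbar * u * s + Z < Fintype.card F := by
    -- The summand `(s - 1) * 2 ^ (s - 2)` enters only through its positivity, which makes the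
    -- degree budget strict.
    have h1 : (0 : ℚ) < u * (((s : ℚ) - 1) * 2 ^ (s - 2)) := by
      have : (2 : ℚ) ≤ s := by exact_mod_cast hs
      have : (0 : ℚ) < s - 1 := by linarith
      have : (0 : ℚ) < u := by exact_mod_cast hu
      positivity
    have h2 : (nbar : ℚ) * u * s + Z < Fintype.card F := by linarith
    exact_mod_cast h2
  obtain ⟨θ, y, hθ, hy⟩ := exists_orderOf_eq_of_dvd (F := F) (nbar := nbar) hu hdvd (by
    have : nbar * u * 1 ≤ nbar * u * s := Nat.mul_le_mul_left _ (by omega)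
    omega)
  let 𝒟 : Finset (Finset (Fin nbar × Fin u)) :=
    Finset.univ.filter fun D => ∃ a, ∀ d ∈ D, rackGroup s d.1 = a
  let P₁ : MvPolynomial (Fin nbar × Fin s) F :=
    (Matrix.vandermonde fun t =>
      (MvPolynomial.X ((Fintype.equivFin (Fin nbar × Fin s)).symm t) :
        MvPolynomial (Fin nbar × Fin s) F) ^ u).det
  let P₂ : MvPolynomial (Fin nbar × Fin s) F := ∏ x, MvPolynomial.X x
  let P₃ : MvPolynomial (Fin nbar × Fin s) F :=
    ∏ D ∈ 𝒟, (localMatrix θ (MvPolynomial.X (R := F)) D).det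
  -- The three factors guarantee distinct `u`-th powers, nonzero points, and local independence of
  -- every set of nodes within one group.
  have hP : P₁ * P₂ * P₃ ≠ 0 := by
    refine mul_ne_zero (mul_ne_zero (MvPolynomial.det_vandermonde_X_pow_ne_zero hu) ?_) ?_
    · exact Finset.prod_ne_zero_iff.2 fun x _ => MvPolynomial.X_ne_zero x
    · exact Finset.prod_ne_zero_iff.2 fun D _ => det_localMatrix_X_ne_zero hy D
  have hdeg : ∀ x, (P₁ * P₂ * P₃).degreeOf x < Fintype.card F := by
    intro x
    have h1 : P₁.degreeOf x ≤ u * (nbar * s - 1) := by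
      simpa using MvPolynomial.degreeOf_det_vandermonde_X_pow_le (F := F) u x
    have h2 : P₂.degreeOf x ≤ 1 := by
      refine (MvPolynomial.degreeOf_prod_le _ _ _).trans (le_of_eq ?_)
      simp [MvPolynomial.degreeOf_X]
    have h3 : P₃.degreeOf x ≤ Z := by
      refine (MvPolynomial.degreeOf_prod_le _ _ _).trans ?_
      refine (Finset.sum_le_sum fun D _ => degreeOf_det_localMatrix_le θ D x).trans ?_
      refine sum_degree_le x.1 (Finset.univ.filter fun p => rackGroup s p = rackGroup s x.1)
        (by simp) (card_rackGroup_le _) 𝒟 ?_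
      intro D hD hx q hq
      obtain ⟨a, ha⟩ := (Finset.mem_filter.1 hD).2
      obtain ⟨d, hd, hdx⟩ := Finset.mem_image.1 hx
      obtain ⟨d', hd', rfl⟩ := Finset.mem_image.1 hq
      rw [Finset.mem_filter, ← hdx, ha d hd, ha d' hd']
      exact ⟨Finset.mem_univ _, rfl⟩
    have h4 := MvPolynomial.degreeOf_mul_le x (P₁ * P₂) P₃
    have h5 := MvPolynomial.degreeOf_mul_le x P₁ P₂
    have h6 : u * (nbar * s - 1) + u = nbar * u * s := by
      have h7 : 1 ≤ nbar * s := Nat.mul_pos hnbar (by omega)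
      calc u * (nbar * s - 1) + u = u * (nbar * s - 1 + 1) := by ring
        _ = nbar * u * s := by rw [Nat.sub_add_cancel h7]; ring
    omega
  obtain ⟨z, hz⟩ := MvPolynomial.exists_eval_ne_zero hP hdeg
  rw [map_mul, map_mul] at hz
  have hz₁ := left_ne_zero_of_mul (left_ne_zero_of_mul hz)
  have hz₂ := right_ne_zero_of_mul (left_ne_zero_of_mul hz)
  have hz₃ := right_ne_zero_of_mul hz
  have hzpow : Function.Injective fun x => z x ^ u := by
    have h1 : MvPolynomial.aeval z P₁ = (Matrix.vandermonde fun t =>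
        z ((Fintype.equivFin (Fin nbar × Fin s)).symm t) ^ u).det := by
      rw [AlgHom.map_det]
      congr 1
      ext i j
      simp [Matrix.vandermonde_apply]
    rw [h1, Matrix.det_vandermonde_ne_zero_iff] at hz₁
    intro x x' hx
    have := @hz₁ (Fintype.equivFin _ x) (Fintype.equivFin _ x') (by simpa using hx)
    exact (Fintype.equivFin _).injective this
  have hzne : ∀ x, z x ≠ 0 := by
    intro x hx
    refine hz₂ ?_
    rw [map_prod]
    exact Finset.prod_eq_zero (Finset.mem_univ x) (by rw [MvPolynomial.aeval_X, hx])
  refine ⟨θ, fun p e => z (p, e), hθ, ?_, ?_⟩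
  · rintro ⟨g, x⟩ ⟨g', x'⟩ h
    have h : θ ^ (g : ℕ) * z x = θ ^ (g' : ℕ) * z x' := h
    have hθu : ∀ g : ℕ, (θ ^ g) ^ u = 1 := fun g => by
      rw [← pow_mul, mul_comm, pow_mul, ← hθ, pow_orderOf_eq_one, one_pow]
    have h1 := congrArg (· ^ u) h
    simp only [mul_pow, hθu, one_mul] at h1
    obtain rfl := hzpow h1
    have h2 := mul_right_cancel₀ (hzne x) h
    have h3 : (g : ℕ) = g' := pow_injOn_Iio_orderOf (by rw [hθ]; exact g.2)
      (by rw [hθ]; exact g'.2) h2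
    rw [Fin.ext h3]
  · intro a D hD
    refine (det_localMatrix_ne_zero_iff θ z D).1 ?_
    rw [← aeval_det_localMatrix]
    intro h
    refine hz₃ ?_
    rw [map_prod]
    exact Finset.prod_eq_zero (Finset.mem_filter.2 ⟨Finset.mem_univ D, a, hD⟩) h

/-! ### The two ranges of `h` -/

/-- The equations for different `w` are independent of each other, so the helper set and the degree
bound `ρ` may depend on `w`. This is what lets the additional rack send less than the others. -/
theorem coupledLayerCode_failed_eq_zero {F : Type*} [Field F] {nbar u s r h : ℕ} [NeZero s]
    {θ : F} {lam : Fin nbar → Fin s → F} (hθ : orderOf θ = u) (hu : 0 < u)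
    (hinj : Function.Injective
      (fun x : Fin u × Fin nbar × Fin s => θ ^ (x.1 : ℕ) * lam x.2.1 x.2.2))
    (hloc : IsLocallyIndependent u s θ lam)
    {c : Fin nbar × Fin u → RackLayer nbar s → F} (hc : c ∈ coupledLayerCode nbar u s r θ lam)
    (host : Fin nbar) {I : Finset (Fin u)} (hI : I.card = h)
    (hsurv : ∀ g ∉ I, c (host, g) = 0)
    (hy : ∀ w < h, ∃ (H : Finset (Fin nbar)) (ρ : ℕ), host ∉ H ∧ ρ + H.card + 1 = s + nbar ∧
      w + u * (ρ - 1) < r ∧ ∀ p ∈ H, ∀ i : RackLayer nbar s,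
        i (rackGroup s host) = rackPos s host → rackSymbol θ lam c p i w = 0)
    (g : Fin u) : c (host, g) = 0 := by
  ext j
  refine eq_zero_of_rackSymbol_eq_zero hinj hI hsurv (fun w hw => ?_) g
  obtain ⟨H, ρ, hH, hρ, hr, hyw⟩ := hy w hw
  exact rackSymbol_host_eq_zero (by rw [← hθ]; exact pow_orderOf_eq_one θ) hu hinj hloc hc host H
    hH hρ hr hyw j

/-- The degree budget with `dbar` helpers, where `ρ = nbar - kbar`. It is the origin of the
threshold `h ≤ u - v`. -/
theorem parity_degree_lt {nbar u kbar v w : ℕ} (hk : kbar + 1 ≤ nbar) (hw : w + v < u) :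
    w + u * (nbar - kbar - 1) < nbar * u - (kbar * u + v) := by
  obtain ⟨t, rfl⟩ : ∃ t, nbar = kbar + 1 + t := ⟨nbar - (kbar + 1), by omega⟩
  have h1 : kbar + 1 + t - kbar - 1 = t := by omega
  rw [h1]
  have h2 : (kbar + 1 + t) * u = kbar * u + u + u * t := by ring
  omega

/-- With one more helper `ρ` drops to `nbar - kbar - 1`, which frees a full `u` degrees. -/
theorem parity_degree_lt_of_lt {nbar u kbar v w : ℕ} (hk : kbar + 2 ≤ nbar) (hw : w < u)
    (hv : v < u) :
    w + u * (nbar - kbar - 2) < nbar * u - (kbar * u + v) := by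
  obtain ⟨t, rfl⟩ : ∃ t, nbar = kbar + 2 + t := ⟨nbar - (kbar + 2), by omega⟩
  have h1 : kbar + 2 + t - kbar - 2 = t := by omega
  rw [h1]
  have h2 : (kbar + 2 + t) * u = kbar * u + u + u + u * t := by ring
  omega

theorem theorem1 {F : Type*} [Field F] [Fintype F]
    (n k nbar u kbar v dbar s l : ℕ) [NeZero s]
    (hu : 0 < u) (hn : n = nbar * u) (hv : v < u) (hk : k = kbar * u + v)
    (hkbar : 1 ≤ kbar) (hd₁ : kbar + 1 ≤ dbar) (hd₂ : dbar + 1 ≤ nbar)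
    (hs : s + kbar = dbar + 1)
    (hl : l = s ^ ⌈(nbar : ℚ) / (s : ℚ)⌉₊)
    (hdvd : u ∣ Fintype.card F - 1)
    (hq : (n : ℚ) * s + u * (rackOmega s u + ((s : ℚ) - 1) * 2 ^ (s - 2)) ≤ Fintype.card F) :
    ∃ (θ : F) (lam : Fin nbar → Fin s → F),
      orderOf θ = u ∧
      Function.Injective (fun x : Fin u × Fin nbar × Fin s => θ ^ (x.1 : ℕ) * lam x.2.1 x.2.2) ∧
      -- the code is an MDS array code with sub-packetization `l`
      Fintype.card (RackLayer nbar s) = l ∧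
      IsMDSArrayCode k (coupledLayerCode nbar u s (n - k) θ lam) ∧
      -- repair of `1 ≤ h ≤ u - v` nodes, with optimal bandwidth; optimal access if `h = u - v`
      (∀ h : ℕ, 1 ≤ h → h + v ≤ u →
        IsRackBandwidthLowerBound F nbar u (RackLayer nbar s) k dbar h
          ((dbar : ℚ) * h * l / s) ∧
        IsRackAccessLowerBound F nbar u (RackLayer nbar s) k dbar h
          ((dbar : ℚ) * h * l / s) ((dbar : ℚ) * h * u * l / (s * ((u : ℚ) - v))) ∧
        ∀ (host : Fin nbar) (I : Finset (Fin u)) (H : Finset (Fin nbar)),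
          I.card = h → H.card = dbar → host ∉ H →
          ∃ S : RackRepairScheme (coupledLayerCode nbar u s (n - k) θ lam) host I H,
            (∀ j, (S.load j : ℚ) = (h : ℚ) * l / s) ∧
            (S.bandwidth : ℚ) = (dbar : ℚ) * h * l / s ∧
            (h + v = u →
              (S.accessed : ℚ) = (dbar : ℚ) * h * u * l / (s * ((u : ℚ) - v)))) ∧
      -- repair of `u - v + 1 ≤ h ≤ u` nodes, with one additional helper rack `i`
      (∀ h : ℕ, u + 1 ≤ h + v → h ≤ u →
        IsRackBandwidthLowerBound F nbar u (RackLayer nbar s) k dbar h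
          ((dbar : ℚ) * h * l / s) ∧
        ∀ (host : Fin nbar) (I : Finset (Fin u)) (H : Finset (Fin nbar)) (i : Fin nbar),
          I.card = h → H.card = dbar → host ∉ H → i ∉ H → i ≠ host →
          ∃ S : RackRepairScheme (coupledLayerCode nbar u s (n - k) θ lam) host I (insert i H),
            (∀ j, j.1 ∈ H → (S.load j : ℚ) = (h : ℚ) * l / s) ∧
            (∀ j, j.1 = i → (S.load j : ℚ) = ((h : ℚ) - u + v) * l / s) ∧
            (S.bandwidth : ℚ) = (dbar : ℚ) * h * l / s + ((h : ℚ) - u + v) * l / s ∧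
            (S.bandwidth : ℚ) < (1 + 1 / (dbar : ℚ)) * ((dbar : ℚ) * h * l / s)) := by
  subst hn hk
  have hs0 : 0 < s := Nat.pos_of_ne_zero (NeZero.ne s)
  have hsq : (0 : ℚ) < s := by exact_mod_cast hs0
  have hl0 : 0 < l := hl ▸ pow_pos hs0 _
  have hlq : (0 : ℚ) < l := by exact_mod_cast hl0
  have hcardL : Fintype.card (RackLayer nbar s) = l := by
    rw [hl, Fintype.card_fun, Fintype.card_fin, Fintype.card_fin]
  obtain ⟨θ, lam, hθ, hinj, hloc⟩ := exists_isLocallyIndependent (F := F) (nbar := nbar) hu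
    (by omega) (by omega : 2 ≤ s) hdvd (by push_cast at hq; exact hq)
  have hband : ∀ h : ℕ, IsRackBandwidthLowerBound F nbar u (RackLayer nbar s) (kbar * u + v) dbar h
      ((dbar : ℚ) * h * l / s) := fun h => by
    rw [← hcardL]
    exact isRackBandwidthLowerBound hv rfl hkbar hs hs0
  have hkn : kbar * u + v ≤ nbar * u := by
    calc kbar * u + v ≤ kbar * u + u := by omega
      _ = (kbar + 1) * u := by ring
      _ ≤ nbar * u := Nat.mul_le_mul_right _ (by omega)
  refine ⟨θ, lam, hθ, hinj, hcardL, coupledLayerCode_isMDSArrayCode hkn hinj hloc, ?_, ?_⟩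
  · intro h hh hhv
    refine ⟨hband h, ?_, ?_⟩
    · rw [← hcardL]
      exact isRackAccessLowerBound hv rfl hkbar hs hs0
    · intro host I H hI hH hhost
      obtain ⟨S, hS⟩ := exists_rackRepairScheme (r := nbar * u - (kbar * u + v)) (θ := θ)
        (lam := lam) host I H (fun _ => Finset.range h) (by
          intro c hc hy hsurv g _
          refine coupledLayerCode_failed_eq_zero hθ hu hinj hloc hc host hI hsurv
            (fun w hw => ⟨H, nbar - kbar, hhost, by omega, parity_degree_lt (by omega) (by omega),
              fun p hp => hy p hp w (Finset.mem_range.2 hw)⟩) g)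
      have hload : ∀ j, (S.load j : ℚ) = (h : ℚ) * l / s := by
        intro j
        rw [eq_div_iff hsq.ne', hl]
        have := (hS j).1
        rw [Finset.card_range] at this
        exact_mod_cast this
      refine ⟨S, hload, ?_, ?_⟩
      · rw [RackRepairScheme.bandwidth, Nat.cast_sum, Finset.sum_congr rfl fun j _ => hload j,
          Finset.sum_const, Finset.card_univ, Fintype.card_coe, hH, nsmul_eq_mul]
        ring
      · intro huv
        have hacc : ∀ j, ((S.access j).card : ℚ) = (u : ℚ) * l / s := by
          intro j
          rw [eq_div_iff hsq.ne', hl]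
          exact_mod_cast (hS j).2
        rw [RackRepairScheme.accessed, Nat.cast_sum, Finset.sum_congr rfl fun j _ => hacc j,
          Finset.sum_const, Finset.card_univ, Fintype.card_coe, hH, nsmul_eq_mul]
        have hhq : (h : ℚ) ≠ 0 := by exact_mod_cast (by omega : h ≠ 0)
        have : (u : ℚ) - v = h := by
          rw [← huv]
          push_cast
          ring
        rw [this]
        field_simp
  · intro h hhv hhu
    refine ⟨hband h, ?_⟩
    intro host I H i hI hH hhost hiH hihost
    -- The existence of a host and an additional rack outside `H` already forces this.
    have hnbar : dbar + 2 ≤ nbar := by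
      have := Finset.card_le_univ (insert host (insert i H))
      rw [Finset.card_insert_of_notMem (by
        rw [Finset.mem_insert, not_or]
        exact ⟨hihost.symm, hhost⟩), Finset.card_insert_of_notMem hiH, hH, Fintype.card_fin] at this
      exact this
    have hhost' : host ∉ insert i H := by
      rw [Finset.mem_insert, not_or]
      exact ⟨hihost.symm, hhost⟩
    obtain ⟨S, hS⟩ := exists_rackRepairScheme (r := nbar * u - (kbar * u + v)) (θ := θ)
      (lam := lam) host I (insert i H)
      -- The additional rack is needed only for `u - v ≤ w < h`, so it sends `h - (u - v)` symbols
      -- for each supporting layer.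
      (fun p => if p = i then Finset.Ico (u - v) h else Finset.range h) (by
        intro c hc hy hsurv g _
        refine coupledLayerCode_failed_eq_zero hθ hu hinj hloc hc host hI hsurv
          (fun w hw => ?_) g
        rcases lt_or_ge w (u - v) with hwv | hwv
        · refine ⟨H, nbar - kbar, hhost, by omega, parity_degree_lt (by omega) (by omega),
            fun p hp => hy p (Finset.mem_insert_of_mem hp) w ?_⟩
          rw [if_neg (fun hpi : p = i => hiH (hpi ▸ hp))]
          exact Finset.mem_range.2 hw
        · refine ⟨insert i H, nbar - kbar - 1, hhost', ?_,
            parity_degree_lt_of_lt (by omega) (by omega) hv, fun p hp => hy p hp w ?_⟩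
          · rw [Finset.card_insert_of_notMem hiH]
            omega
          · split_ifs
            · exact Finset.mem_Ico.2 ⟨hwv, hw⟩
            · exact Finset.mem_range.2 hw)
    have hload : ∀ j, j.1 ∈ H → (S.load j : ℚ) = (h : ℚ) * l / s := by
      intro j hj
      rw [eq_div_iff hsq.ne', hl]
      have := (hS j).1
      rw [if_neg (fun hji : j.1 = i => hiH (hji ▸ hj)), Finset.card_range] at this
      exact_mod_cast this
    have hloadi : ∀ j, j.1 = i → (S.load j : ℚ) = ((h : ℚ) - u + v) * l / s := by
      intro j hj
      rw [eq_div_iff hsq.ne', hl]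
      have h1 := (hS j).1
      rw [if_pos hj, Nat.card_Ico] at h1
      have h2 : ((h - (u - v) : ℕ) : ℚ) = (h : ℚ) - u + v := by
        rw [Nat.cast_sub (by omega), Nat.cast_sub hv.le]
        ring
      rw [← h2]
      exact_mod_cast h1
    have hbw : (S.bandwidth : ℚ) = (dbar : ℚ) * h * l / s + ((h : ℚ) - u + v) * l / s := by
      have h1 : ∀ j : {j // j ∈ insert i H}, (S.load j : ℚ) =
          if j.1 = i then ((h : ℚ) - u + v) * l / s else (h : ℚ) * l / s := by
        intro j
        split_ifs with hj
        · exact hloadi j hj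
        · exact hload j ((Finset.mem_insert.1 j.2).resolve_left hj)
      rw [RackRepairScheme.bandwidth, Nat.cast_sum, Finset.sum_congr rfl fun j _ => h1 j,
        Finset.sum_coe_sort (insert i H)
          (fun p => if p = i then ((h : ℚ) - u + v) * l / s else (h : ℚ) * l / s),
        Finset.sum_insert hiH, if_pos rfl, Finset.sum_congr rfl fun p hp =>
          if_neg (fun hpi : p = i => hiH (hpi ▸ hp)), Finset.sum_const, hH, nsmul_eq_mul]
      ring
    refine ⟨S, hload, hloadi, hbw, ?_⟩
    have hd : (0 : ℚ) < dbar := by exact_mod_cast (by omega : 0 < dbar)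
    have hvq : (v : ℚ) < u := by exact_mod_cast hv
    -- The claimed bound amounts to one further full load `h * l / s`; the additional rack sends
    -- strictly less because `v < u`.
    have h2 : (1 + 1 / (dbar : ℚ)) * ((dbar : ℚ) * h * l / s) =
        (dbar : ℚ) * h * l / s + (h : ℚ) * l / s := by
      field_simp
    rw [hbw, h2]
    have h3 : ((h : ℚ) - u + v) * l / s < (h : ℚ) * l / s := by
      rw [div_lt_div_iff_of_pos_right hsq]
      exact mul_lt_mul_of_pos_right (by linarith) hlq
    linarith
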